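/- For a finitely generated abelian group $Q$ and a homomorphism $\chi : Q \to \mathbb{R}$ put $Q_\chi = \{q \in Q \mid \chi(q) \ge 0\}$, and let $S(Q) = (\operatorname{Hom}(Q,\mathbb{R}) \setminus \{0\})/\!\sim$, where $\chi \sim r\chi$ for every real $r > 0$. For a $\mathbb{Z}Q$-module $M$ let $\Sigma_M^c(Q)$ be the set of those $[\chi] \in S(Q)$ for which $M$ is not finitely generated over $\mathbb{Z}Q_\chi$. For $m \ge 0$, the module $M$ is called $m$-tame over $\mathbb{Z}Q$ if $\chi_1 + \dots + \chi_m \ne 0$ whenever $[\chi_1], \dots, [\chi_m] \in \Sigma_M^c(Q)$. A group has finite Prüfer rank if there is an upper bound on the number of generators needed for its finitely generated subgroups. Let $G$ be a finitely generated group and $A$ a normal subgroup of $G$ such that $A$ and $Q = G/A$ are abelian; regard $A$ as a $\mathbb{Z}Q$-module by conjugation. Let $H$ be a finite group acting on $G$ by automorphisms, and let $n$ and $d$ be integers with $d \ge 1$ and $d|H| \le n$. Suppose that $A$ is $n$-tame as a $\mathbb{Z}Q$-module. Write $C_G(H)$, $C_A(H)$ for the subgroups of elements of $G$, $A$ that are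 fixed by $H$. Then the following hold. (a) If $A$ is $H$-invariant, then $C_A(H)$ is a finitely generated and $d$-tame $\mathbb{Z}C_Q(H)$-module, where $C_Q(H)$ is the subgroup of elements of $Q = G/A$ fixed by the induced action of $H$ and it acts on $C_A(H)$ by conjugation. (b) Assume that one of the following holds: (i) $G$ has finite Prüfer rank and $A = G'$ is the commutator subgroup of $G$; or (ii) $A$ is $H$-invariant and has an $H$-invariant complement in $G$, that is, $G = \widehat{Q} \ltimes A$ for an $H$-invariant subgroup $\widehat{Q} \cong Q$ of $G$. Then $C_A(H)$ is a finitely generated and $d$-tame $\mathbb{Z}[C_G(H)/C_A(H)]$-module, the action being by conjugation. -/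

import Mathlib

open scoped MonoidAlgebra IsMulCommutative

namespace BieriStrebel

noncomputable section

/-- The character sphere `S(Q)`: nonzero homomorphisms `χ : Q → ℝ` up to positive real multiples. -/
abbrev CharSphere (Q : Type*) [Group Q] : Type _ :=
  Module.Ray ℝ (Additive Q →+ ℝ)

/-- The submonoid `Q_χ = {q ∈ Q | χ(q) ≥ 0}` of `Q`. -/
def nonnegSubmonoid {Q : Type*} [Group Q] (χ : Additive Q →+ ℝ) : Submonoid Q where
  carrier := {q | 0 ≤ χ (Additive.ofMul q)}
  one_mem' := by simp
  mul_mem' := by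
    intro a b ha hb
    change 0 ≤ χ (Additive.ofMul a + Additive.ofMul b)
    rw [map_add]
    exact add_nonneg ha hb

/-- The monoid ring `ℤ Q_χ`, as a subring (`ℤ`-subalgebra) of the group ring `ℤ Q`. -/
def nonnegSubalgebra {Q : Type*} [Group Q] (χ : Additive Q →+ ℝ) : Subalgebra ℤ ℤ[Q] :=
  (MonoidAlgebra.mapDomainAlgHom ℤ ℤ (nonnegSubmonoid χ).subtype).range

/-- The Bieri-Strebel invariant
`Σ_M(Q) = {[χ] ∈ S(Q) | M is finitely generated over ℤ Q_χ}` of a `ℤ Q`-module `M`. -/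
def sigma (Q : Type*) [Group Q] (M : Type*) [AddCommGroup M] [Module ℤ[Q] M] :
    Set (CharSphere Q) :=
  {p | ∃ (χ : Additive Q →+ ℝ) (hχ : χ ≠ 0),
    p = rayOfNeZero ℝ χ hχ ∧ Module.Finite (nonnegSubalgebra χ) M}

/-- `M` is `m`-tame as a `ℤ Q`-module: whenever `[χ₁], …, [χₘ]` lie in the complement of
`Σ_M(Q)` in the character sphere, `χ₁ + ⋯ + χₘ ≠ 0`. -/
def IsTame (Q : Type*) [Group Q] (M : Type*) [AddCommGroup M] [Module ℤ[Q] M] (m : ℕ) : Prop :=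
  ∀ χ : Fin m → (Additive Q →+ ℝ),
    (∀ i, ∃ h : χ i ≠ 0, rayOfNeZero ℝ (χ i) h ∈ (sigma Q M)ᶜ) → ∑ i, χ i ≠ 0

/-- `G` has finite Prüfer rank: there is an upper bound on the number of generators of the finitely
generated subgroups of `G`. -/
def FinitePruferRank (G : Type*) [Group G] : Prop :=
  ∃ r : ℕ, ∀ K : Subgroup G, K.FG → ∃ S : Finset G, S.card ≤ r ∧ Subgroup.closure (S : Set G) = K

section Conjugation

variable {G : Type*} [Group G] (A : Subgroup G) [A.Normal] [IsMulCommutative A]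

/-- The conjugation action of `G ⧸ A` on an abelian normal subgroup `A`, `(gA) • a = g a g⁻¹`. -/
def conjHom : G ⧸ A →* MulAut A :=
  QuotientGroup.lift A (MulAut.conjNormal (H := A)) (by
    intro b hb
    ext a
    have hcomm := congrArg Subtype.val (mul_comm (⟨b, hb⟩ : A) a)
    simp only [Subgroup.coe_mul] at hcomm
    simp [MulAut.conjNormal_apply, hcomm])

theorem coe_conjHom_mk (g : G) (a : A) :
    ((conjHom A (g : G ⧸ A) a : A) : G) = g * a * g⁻¹ := by
  exact MulAut.conjNormal_apply g a

/-- The abelian normal subgroup `A`, written additively, as a representation of `G ⧸ A` over `ℤ`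
by conjugation. -/
def conjRep : Representation ℤ (G ⧸ A) (Additive A) :=
  letI : MulDistribMulAction (G ⧸ A) A := MulDistribMulAction.compHom A (conjHom A)
  Representation.ofMulDistribMulAction (G ⧸ A) A

theorem conjRep_apply (q : G ⧸ A) (a : A) :
    conjRep A q (Additive.ofMul a) = Additive.ofMul (conjHom A q a) := rfl

end Conjugation

section Centralizers

variable {G : Type*} [Group G] (H : Type*) [Group H] [MulDistribMulAction H G]

/-- The automorphism of `G ⧸ A` induced by `h : H`, for an `H`-invariant normal subgroup `A`. -/
def quotientEnd {A : Subgroup G} [A.Normal] (hA : ∀ (h : H), ∀ a ∈ A, h • a ∈ A) (h : H) :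
    G ⧸ A →* G ⧸ A :=
  QuotientGroup.map A A (MulDistribMulAction.toMonoidHom G h) (fun a ha => hA h a ha)

/-- `C_Q(H)` for `Q = G ⧸ A`: the elements of `Q` fixed by the induced action of `H`. -/
def quotientCentralizer {A : Subgroup G} [A.Normal] (hA : ∀ (h : H), ∀ a ∈ A, h • a ∈ A) :
    Subgroup (G ⧸ A) where
  carrier := {q | ∀ h : H, quotientEnd H hA h q = q}
  one_mem' := fun h => map_one _
  mul_mem' := fun {x y} hx hy h => by rw [map_mul, hx h, hy h]
  inv_mem' := fun {x} hx h => by rw [map_inv, hx h]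

/-- `C_A(H)`, as a `C_Q(H)`-stable additive subgroup of the `ℤ Q`-module `A`, where `Q = G ⧸ A`. -/
def centralizerSubrep {A : Subgroup G} [A.Normal] [IsMulCommutative A]
    (hA : ∀ (h : H), ∀ a ∈ A, h • a ∈ A) :
    Subrepresentation ((conjRep A).comp (quotientCentralizer H hA).subtype) where
  toSubmodule := AddSubgroup.toIntSubmodule
    (Subgroup.toAddSubgroup ((FixedPoints.subgroup H G).subgroupOf A))
  apply_mem_toSubmodule := by
    rintro ⟨q, hq⟩ v hv
    induction q using QuotientGroup.induction_on with
    | H g =>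
      change ∀ h : H, h • ((Additive.toMul v : A) : G) = (Additive.toMul v : A) at hv
      change ∀ h : H, h • ((conjHom A (g : G ⧸ A) (Additive.toMul v) : A) : G)
        = (conjHom A (g : G ⧸ A) (Additive.toMul v) : A)
      intro h
      have hg : ((h • g : G) : G ⧸ A) = (g : G ⧸ A) := hq h
      have hb : g⁻¹ * h • g ∈ A := QuotientGroup.eq.mp hg.symm
      set a : A := Additive.toMul v
      have hc := congrArg Subtype.val (mul_comm (⟨_, hb⟩ : A) a)
      simp only [Subgroup.coe_mul] at hc
      rw [coe_conjHom_mk, smul_mul', smul_mul', smul_inv', hv h]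
      calc h • g * (a : G) * (h • g)⁻¹ = g * ((g⁻¹ * h • g) * a) * (h • g)⁻¹ := by group
        _ = g * (a * (g⁻¹ * h • g)) * (h • g)⁻¹ := by rw [hc]
        _ = g * a * g⁻¹ := by group

/-- The `ℤ C_Q(H)`-module `C_A(H)`, where `Q = G ⧸ A`. -/
abbrev centralizerModule {A : Subgroup G} [A.Normal] [IsMulCommutative A]
    (hA : ∀ (h : H), ∀ a ∈ A, h • a ∈ A) : Type _ :=
  (centralizerSubrep H hA).toRepresentation.asModule

end Centralizers

/-- An abelian normal subgroup `A` of `G` as a `ℤ[G ⧸ A]`-module via conjugation. -/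
abbrev conjModule {G : Type*} [Group G] (A : Subgroup G) [A.Normal] [IsMulCommutative A] :
    Type _ :=
  (conjRep A).asModule

end

end BieriStrebel

/-!
The proof rests on a finiteness criterion of Bieri and Strebel. Let `Q` be a finitely generated
abelian group, `M` a finitely generated `ℤQ`-module and `P` a submonoid of `Q`; if `M` is finitely
generated over `ℤQ_χ` for every nonzero `χ : Q → ℝ` with `χ|P ≥ 0`, then `M` is finitely generated
over `ℤP` (`finite_monoidSubalgebra_of_forall_character`). Suppose not, and enlarge `P` to a
submonoid maximal among those for which the conclusion fails. If `M` is finitely generated over both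
`ℤP[x]` and `ℤP[x⁻¹]`, then it is so over `ℤP` (`finite_monoidSubalgebra_of_sup_powers`), so a
maximal `P` is total: it contains `x` or `x⁻¹` for each `x`. A proper total submonoid lies in some
`Q_χ`, since a maximal proper submonoid containing it defines an archimedean ordered quotient of `Q`,
which embeds in `ℝ` (`exists_character_nonneg`). As `M` is finitely generated over `ℤQ_χ`, Nakayama's
lemma gives an element of `ℤQ` supported in `{χ > 0}` that acts as the identity
(`exists_mul_smul_eq_self`). By totality `{χ > 0} ⊆ P`, and powers of this element show that `M` is
finitely generated over `ℤP` (`finite_monoidSubalgebra_of_mul_smul_eq_self`), a contradiction.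

Now let `M = A`, and let `Q₁` be a subgroup of `Q` that contains a positive power of `∏ h, h • q` for
each `q ∈ Q`. The complement of `Σ_M` is stable under `H`. If it contained a character vanishing on
`Q₁`, the sum of the `H`-translates of that character would be zero, against tameness. So the
criterion makes `M` finitely generated over `ℤQ₁`, and `C_A(H)` is finitely generated because `ℤQ₁`
is noetherian. The criterion, applied to half-spaces of `Q₁`, also shows that a character of `Q₁` in
the complement of the invariant of `C_A(H)` extends to one of `Q` in the complement of `Σ_M`. Given
`d` of the former with sum zero, the `d|H|` translates of the extensions have sum zero, against
tameness (`finite_and_isTame_of_norm`).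

For the first assertion `Q₁ = C_Q(H)`. For the second `Q₁` is the image of `C_G(H)`, and each element
of `C_Q(H)` must have a positive power in `Q₁`. For an invariant complement this is immediate, and
for finite Prüfer rank it follows from the finiteness of `H¹(H, A)` (`exists_fixed_mk_eq_pow`).
-/

open scoped MonoidAlgebra IsMulCommutative

namespace BieriStrebel

/-! ### Finite generation over monoid rings -/

section MonoidRing

variable {Q : Type*} [Group Q]

/-- The monoid ring `ℤP` of a submonoid `P` of `Q`, as a subalgebra of `ℤQ`. -/
noncomputable def monoidSubalgebra (P : Submonoid Q) : Subalgebra ℤ ℤ[Q] :=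
  (MonoidAlgebra.mapDomainAlgHom ℤ ℤ P.subtype).range

theorem of_mem_monoidSubalgebra {P : Submonoid Q} {p : Q} (hp : p ∈ P) :
    MonoidAlgebra.of ℤ Q p ∈ monoidSubalgebra P :=
  ⟨MonoidAlgebra.of ℤ P ⟨p, hp⟩, by simp⟩

@[elab_as_elim]
theorem monoidSubalgebra_induction {P : Submonoid Q}
    {motive : (r : ℤ[Q]) → r ∈ monoidSubalgebra P → Prop}
    (of : ∀ p (hp : p ∈ P), motive (MonoidAlgebra.of ℤ Q p) (of_mem_monoidSubalgebra hp))
    (add : ∀ x y hx hy, motive x hx → motive y hy → motive (x + y) (add_mem hx hy))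
    (smul : ∀ (k : ℤ) x hx, motive x hx → motive (k • x) (Subalgebra.smul_mem _ hx k))
    {r : ℤ[Q]} (hr : r ∈ monoidSubalgebra P) : motive r hr := by
  obtain ⟨x, rfl⟩ := hr
  change motive (MonoidAlgebra.mapDomainAlgHom ℤ ℤ P.subtype x) _
  induction x using MonoidAlgebra.induction_on with
  | of p => simpa using of p p.2
  | add x y hx hy => simp only [map_add]; exact add _ _ ⟨x, rfl⟩ ⟨y, rfl⟩ hx hy
  | smul k x hx => simp only [map_smul]; exact smul k _ ⟨x, rfl⟩ hx

theorem mem_monoidSubalgebra_top (r : ℤ[Q]) : r ∈ monoidSubalgebra (⊤ : Submonoid Q) := by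
  induction r using MonoidAlgebra.induction_on with
  | of p => exact of_mem_monoidSubalgebra trivial
  | add x y hx hy => exact add_mem hx hy
  | smul k x hx => exact Subalgebra.smul_mem _ hx k

variable {M : Type*} [AddCommGroup M] [Module ℤ[Q] M]

theorem smul_mem_of_mem_monoidSubalgebra {P : Submonoid Q} {W : AddSubgroup M}
    (hW : ∀ p ∈ P, ∀ w ∈ W, MonoidAlgebra.of ℤ Q p • w ∈ W) {r : ℤ[Q]}
    (hr : r ∈ monoidSubalgebra P) {w : M} (hw : w ∈ W) : r • w ∈ W := by
  induction hr using monoidSubalgebra_induction with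
  | of p hp => exact hW p hp w hw
  | add x y _ _ hx hy => rw [add_smul]; exact W.add_mem hx hy
  | smul k x _ hx => rw [smul_assoc]; exact W.zsmul_mem hx k

/-- A `P`-stable additive subgroup as a `ℤP`-submodule. -/
def stableSubmodule {P : Submonoid Q} (W : AddSubgroup M)
    (hW : ∀ p ∈ P, ∀ w ∈ W, MonoidAlgebra.of ℤ Q p • w ∈ W) :
    Submodule (monoidSubalgebra P) M where
  __ := W
  smul_mem' r _ hw := smul_mem_of_mem_monoidSubalgebra hW r.2 hw

theorem mem_span_monoidSubalgebra_iff {P : Submonoid Q} {S : Set M} {m : M} :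
    m ∈ Submodule.span (monoidSubalgebra P) S ↔ ∀ W : AddSubgroup M, S ⊆ W →
      (∀ p ∈ P, ∀ w ∈ W, MonoidAlgebra.of ℤ Q p • w ∈ W) → m ∈ W := by
  constructor
  · intro hm W hSW hW
    exact (Submodule.span_le (p := stableSubmodule W hW)).2 hSW hm
  · intro h
    refine h (Submodule.span (monoidSubalgebra P) S).toAddSubgroup Submodule.subset_span ?_
    intro p hp w hw
    exact Submodule.smul_mem _ (⟨_, of_mem_monoidSubalgebra hp⟩ : monoidSubalgebra P) hw

/-- Finite generation over `ℤP` in terms of the action of `P` alone. -/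
theorem finite_monoidSubalgebra_iff {P : Submonoid Q} :
    Module.Finite (monoidSubalgebra P) M ↔ ∃ S : Set M, S.Finite ∧ ∀ W : AddSubgroup M, S ⊆ W →
      (∀ p ∈ P, ∀ w ∈ W, MonoidAlgebra.of ℤ Q p • w ∈ W) → W = ⊤ := by
  rw [Module.finite_def, Submodule.fg_def]
  refine exists_congr fun S => and_congr_right fun _ => ?_
  rw [Submodule.eq_top_iff']
  simp_rw [mem_span_monoidSubalgebra_iff, AddSubgroup.eq_top_iff']
  tauto

theorem finite_monoidSubalgebra_top_iff :
    Module.Finite (monoidSubalgebra (⊤ : Submonoid Q)) M ↔ Module.Finite ℤ[Q] M := by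
  have htop : monoidSubalgebra (⊤ : Submonoid Q) = ⊤ :=
    eq_top_iff.2 fun r _ => mem_monoidSubalgebra_top r
  rw [htop]
  constructor
  · intro h
    exact Module.Finite.of_restrictScalars_finite (⊤ : Subalgebra ℤ ℤ[Q]) _ _
  · intro h
    obtain ⟨S, hS⟩ := h
    refine ⟨S, Submodule.eq_top_iff'.2 fun m => ?_⟩
    have hm : m ∈ Submodule.span ℤ[Q] (S : Set M) := hS ▸ trivial
    induction hm using Submodule.span_induction with
    | mem x hx => exact Submodule.subset_span hx
    | zero => exact zero_mem _
    | add x y _ _ hx hy => exact add_mem hx hy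
    | smul r x _ hx => exact Submodule.smul_mem _ (⟨r, trivial⟩ : (⊤ : Subalgebra ℤ ℤ[Q])) hx

theorem finite_monoidSubalgebra_mono {P P' : Submonoid Q} (h : P ≤ P')
    (hP : Module.Finite (monoidSubalgebra P) M) : Module.Finite (monoidSubalgebra P') M := by
  rw [finite_monoidSubalgebra_iff] at hP ⊢
  obtain ⟨S, hS, hP⟩ := hP
  exact ⟨S, hS, fun W hSW hW => hP W hSW fun p hp => hW p (h hp)⟩

theorem of_smul_of_inv_smul (q : Q) (m : M) :
    MonoidAlgebra.of ℤ Q q • MonoidAlgebra.of ℤ Q q⁻¹ • m = m := by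
  rw [smul_smul, ← map_mul, mul_inv_cancel, map_one, one_smul]

end MonoidRing

section CommGroup

variable {Q : Type*} [CommGroup Q] {M : Type*} [AddCommGroup M] [Module ℤ[Q] M]

/-- Nakayama's lemma for `M = tM`: as `t` is invertible on `M`, some element of `t ℤP` acts as the
identity. -/
theorem exists_mul_smul_eq_self {P : Submonoid Q} {t : Q} (ht : t ∈ P)
    (hM : Module.Finite (monoidSubalgebra P) M) :
    ∃ s ∈ monoidSubalgebra P, ∀ m : M, (MonoidAlgebra.of ℤ Q t * s) • m = m := by
  let T : monoidSubalgebra P := ⟨_, of_mem_monoidSubalgebra ht⟩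
  obtain ⟨r, hr, hrM⟩ := Submodule.exists_sub_one_mem_and_smul_eq_zero_of_fg_of_le_smul
    (Ideal.span {T}) (⊤ : Submodule (monoidSubalgebra P) M) hM.fg_top (by
      intro m _
      rw [← of_smul_of_inv_smul t m]
      exact Submodule.smul_mem_smul (Ideal.mem_span_singleton_self T) trivial)
  obtain ⟨s, hs⟩ := Ideal.mem_span_singleton'.1 hr
  refine ⟨-s, neg_mem s.2, fun m => ?_⟩
  have h1 : MonoidAlgebra.of ℤ Q t * -(s : ℤ[Q]) = 1 - r := by
    have := congrArg (Subtype.val) hs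
    simp only [MulMemClass.coe_mul, AddSubgroupClass.coe_sub, OneMemClass.coe_one, T] at this
    linear_combination -this
  rw [h1, sub_smul, one_smul]
  have := hrM m trivial
  rw [Subalgebra.smul_def] at this
  rw [this, sub_zero]

/-- If `ts` acts as the identity, where `χ(t) > 0` and `s ∈ ℤQ_χ`, then multiplication by powers of
`ts` moves every element of `Q` into `{χ > 0}`, so that generators over `ℤQ` already generate over
`ℤP` for each `P ⊇ {χ > 0}`. -/
theorem finite_monoidSubalgebra_of_mul_smul_eq_self (hfin : Module.Finite ℤ[Q] M)
    {χ : Additive Q →+ ℝ} {t : Q} (ht : 0 < χ (Additive.ofMul t)) {s : ℤ[Q]}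
    (hs : s ∈ monoidSubalgebra (nonnegSubmonoid χ))
    (hts : ∀ m : M, (MonoidAlgebra.of ℤ Q t * s) • m = m) {P : Submonoid Q}
    (hP : ∀ q, 0 < χ (Additive.ofMul q) → q ∈ P) : Module.Finite (monoidSubalgebra P) M := by
  rw [← finite_monoidSubalgebra_top_iff, finite_monoidSubalgebra_iff] at hfin
  obtain ⟨S, hS, hfin⟩ := hfin
  rw [finite_monoidSubalgebra_iff]
  refine ⟨S, hS, fun W hSW hW => ?_⟩
  have hpow : ∀ (N : ℕ) (m : M), (MonoidAlgebra.of ℤ Q (t ^ N) * s ^ N) • m = m := by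
    intro N
    induction N with
    | zero => intro m; rw [pow_zero, pow_zero, map_one, one_mul, one_smul]
    | succ N ih =>
      intro m
      have : MonoidAlgebra.of ℤ Q (t ^ (N + 1)) * s ^ (N + 1) =
          (MonoidAlgebra.of ℤ Q (t ^ N) * s ^ N) * (MonoidAlgebra.of ℤ Q t * s) := by
        rw [map_pow, map_pow]; ring
      rw [this, mul_smul, hts, ih]
  have hpos : ∀ r ∈ monoidSubalgebra (nonnegSubmonoid χ), ∀ u : Q, 0 < χ (Additive.ofMul u) →
      ∀ w ∈ W, (MonoidAlgebra.of ℤ Q u * r) • w ∈ W := by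
    intro r hr
    induction hr using monoidSubalgebra_induction with
    | of p hp =>
      intro u hu w hw
      rw [← map_mul]
      refine hW _ (hP _ ?_) w hw
      rw [ofMul_mul, map_add]
      exact add_pos_of_pos_of_nonneg hu hp
    | add x y _ _ hx hy =>
      intro u hu w hw
      rw [mul_add, add_smul]
      exact W.add_mem (hx u hu w hw) (hy u hu w hw)
    | smul k x _ hx =>
      intro u hu w hw
      rw [mul_smul_comm, smul_assoc]
      exact W.zsmul_mem (hx u hu w hw) k
  have hQW : ∀ (q : Q), ∀ w ∈ W, MonoidAlgebra.of ℤ Q q • w ∈ W := by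
    intro q w hw
    obtain ⟨N, hN⟩ := exists_nat_gt (-χ (Additive.ofMul q) / χ (Additive.ofMul t))
    rw [div_lt_iff₀ ht] at hN
    have := hpos (s ^ N) (pow_mem hs N) (q * t ^ N) (by
      rw [ofMul_mul, ofMul_pow, map_add, map_nsmul, nsmul_eq_mul]; linarith) w hw
    rwa [map_mul, mul_assoc, mul_smul, hpow] at this
  exact hfin W hSW fun q _ => hQW q

/-- The `ℤP`-span of `1, x, …, x ^ N` in `ℤQ`. -/
noncomputable def powerSpan (P : Submonoid Q) (x : Q) (N : ℕ) : AddSubgroup ℤ[Q] :=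
  AddSubgroup.closure {r | ∃ p ∈ P, ∃ i ≤ N, r = MonoidAlgebra.of ℤ Q (p * x ^ i)}

theorem of_pow_mul_mem_powerSpan (P : Submonoid Q) (x : Q) {N : ℕ} (k : ℕ) {r : ℤ[Q]}
    (hr : r ∈ powerSpan P x N) : MonoidAlgebra.of ℤ Q (x ^ k) * r ∈ powerSpan P x (N + k) := by
  induction hr using AddSubgroup.closure_induction with
  | mem r hr =>
    obtain ⟨p, hp, i, hi, rfl⟩ := hr
    refine AddSubgroup.subset_closure ⟨p, hp, i + k, by omega, ?_⟩
    rw [← map_mul, pow_add]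
    congr 1
    rw [mul_left_comm, mul_comm (x ^ i)]
  | zero => rw [mul_zero]; exact zero_mem _
  | add a b _ _ ha hb => rw [mul_add]; exact add_mem ha hb
  | neg a _ ha => rw [mul_neg]; exact neg_mem ha

/-- Denominators in `ℤP[x⁻¹]` are cleared by a power of `x`. -/
theorem exists_pow_mul_mem_powerSpan (P : Submonoid Q) (x : Q) {s : ℤ[Q]}
    (hs : s ∈ monoidSubalgebra (P ⊔ Submonoid.powers x⁻¹)) :
    ∃ N : ℕ, MonoidAlgebra.of ℤ Q (x ^ N) * s ∈ powerSpan P x N := by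
  induction hs using monoidSubalgebra_induction with
  | of q hq =>
    obtain ⟨p, hp, _, ⟨j, rfl⟩, rfl⟩ := Submonoid.mem_sup.1 hq
    refine ⟨j, AddSubgroup.subset_closure ⟨p, hp, 0, zero_le, ?_⟩⟩
    rw [← map_mul]
    simp [mul_comm p]
  | add a b _ _ ha hb =>
    obtain ⟨N, hN⟩ := ha
    obtain ⟨K, hK⟩ := hb
    refine ⟨N + K, ?_⟩
    rw [mul_add]
    refine add_mem ?_ ?_
    · have := of_pow_mul_mem_powerSpan P x K hN
      rwa [← mul_assoc, ← map_mul, ← pow_add, add_comm K] at this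
    · have := of_pow_mul_mem_powerSpan P x N hK
      rwa [← mul_assoc, ← map_mul, ← pow_add, add_comm K] at this
  | smul k a _ ha =>
    obtain ⟨N, hN⟩ := ha
    exact ⟨N, by rw [mul_smul_comm]; exact zsmul_mem hN k⟩

/-- Finite generation over `ℤP[x⁻¹]` makes `x` integral over `ℤP` on `M`, so that finite generation
descends from `ℤP[x]` to `ℤP`. -/
theorem finite_monoidSubalgebra_of_sup_powers {P : Submonoid Q} (x : Q)
    (h₁ : Module.Finite (monoidSubalgebra (P ⊔ Submonoid.powers x)) M)
    (h₂ : Module.Finite (monoidSubalgebra (P ⊔ Submonoid.powers x⁻¹)) M) :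
    Module.Finite (monoidSubalgebra P) M := by
  obtain ⟨s, hs, hsM⟩ := exists_mul_smul_eq_self
    (Submonoid.mem_sup_right (Submonoid.mem_powers x⁻¹)) h₂
  obtain ⟨N, hN⟩ := exists_pow_mul_mem_powerSpan P x hs
  have hint : ∀ m : M, MonoidAlgebra.of ℤ Q (x ^ (N + 1)) • m =
      (MonoidAlgebra.of ℤ Q (x ^ N) * s) • m := by
    intro m
    conv_lhs => rw [← hsM m]
    rw [smul_smul, ← mul_assoc, ← map_mul, pow_succ, mul_inv_cancel_right]
  rw [finite_monoidSubalgebra_iff] at h₁ ⊢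
  obtain ⟨S, hS, h₁⟩ := h₁
  refine ⟨⋃ i ∈ Finset.range (N + 1), (fun m => MonoidAlgebra.of ℤ Q (x ^ i) • m) '' S,
    Set.Finite.biUnion (Finset.finite_toSet _) fun i _ => hS.image _, fun W hSW hW => ?_⟩
  have hxS : ∀ i ≤ N, ∀ m ∈ S, MonoidAlgebra.of ℤ Q (x ^ i) • m ∈ W := by
    intro i hi m hm
    exact hSW (Set.mem_biUnion (Finset.mem_coe.2 (Finset.mem_range.2 (Nat.lt_succ_of_le hi)))
      ⟨m, hm, rfl⟩)
  -- the `ℤP`-span of `x ^ i • m`, `i ≤ N`, is stable under `x`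
  let V : AddSubgroup M := AddSubgroup.closure
    {v | ∃ p ∈ P, ∃ i ≤ N, ∃ m ∈ S, v = MonoidAlgebra.of ℤ Q (p * x ^ i) • m}
  have hVW : V ≤ W := by
    rw [AddSubgroup.closure_le]
    rintro _ ⟨p, hp, i, hi, m, hm, rfl⟩
    rw [map_mul, mul_smul]
    exact hW p hp _ (hxS i hi m hm)
  have hSV : S ⊆ V := fun m hm => AddSubgroup.subset_closure
    ⟨1, P.one_mem, 0, zero_le, m, hm, by rw [pow_zero, mul_one, map_one, one_smul]⟩
  have hspan : ∀ r ∈ powerSpan P x N, ∀ m ∈ S, r • m ∈ V := by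
    intro r hr m hm
    induction hr using AddSubgroup.closure_induction with
    | mem r hr =>
      obtain ⟨p, hp, i, hi, rfl⟩ := hr
      exact AddSubgroup.subset_closure ⟨p, hp, i, hi, m, hm, rfl⟩
    | zero => rw [zero_smul]; exact zero_mem _
    | add a b _ _ ha hb => rw [add_smul]; exact add_mem ha hb
    | neg a _ ha => rw [neg_smul]; exact neg_mem ha
  have hPV : ∀ p ∈ P, ∀ v ∈ V, MonoidAlgebra.of ℤ Q p • v ∈ V := by
    intro p hp v hv
    induction hv using AddSubgroup.closure_induction with
    | mem v hv =>
      obtain ⟨p', hp', i, hi, m, hm, rfl⟩ := hv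
      rw [smul_smul, ← map_mul, ← mul_assoc]
      exact AddSubgroup.subset_closure ⟨p * p', P.mul_mem hp hp', i, hi, m, hm, rfl⟩
    | zero => rw [smul_zero]; exact zero_mem _
    | add a b _ _ ha hb => rw [smul_add]; exact add_mem ha hb
    | neg a _ ha => rw [smul_neg]; exact neg_mem ha
  have hxV : ∀ v ∈ V, MonoidAlgebra.of ℤ Q x • v ∈ V := by
    intro v hv
    induction hv using AddSubgroup.closure_induction with
    | mem v hv =>
      obtain ⟨p, hp, i, hi, m, hm, rfl⟩ := hv
      have hrw : MonoidAlgebra.of ℤ Q x • MonoidAlgebra.of ℤ Q (p * x ^ i) • m =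
          MonoidAlgebra.of ℤ Q p • MonoidAlgebra.of ℤ Q (x ^ (i + 1)) • m := by
        rw [smul_smul, smul_smul, ← map_mul, ← map_mul, pow_succ', mul_left_comm]
      rw [hrw]
      refine hPV p hp _ ?_
      rcases hi.lt_or_eq with hlt | rfl
      · exact AddSubgroup.subset_closure ⟨1, P.one_mem, i + 1, hlt, m, hm, by rw [one_mul]⟩
      · rw [hint]
        exact hspan _ hN m hm
    | zero => rw [smul_zero]; exact zero_mem _
    | add a b _ _ ha hb => rw [smul_add]; exact add_mem ha hb
    | neg a _ ha => rw [smul_neg]; exact neg_mem ha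
  have hxV' : ∀ j : ℕ, ∀ v ∈ V, MonoidAlgebra.of ℤ Q (x ^ j) • v ∈ V := by
    intro j
    induction j with
    | zero => intro v hv; rwa [pow_zero, map_one, one_smul]
    | succ j ih =>
      intro v hv
      rw [pow_succ, map_mul, mul_smul]
      exact ih _ (hxV v hv)
  have hV : V = ⊤ := by
    refine h₁ V hSV fun q hq v hv => ?_
    obtain ⟨p, hp, _, ⟨j, rfl⟩, rfl⟩ := Submonoid.mem_sup.1 hq
    rw [map_mul, mul_smul]
    exact hPV p hp _ (hxV' j v hv)
  rw [eq_top_iff, ← hV]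
  exact hVW

end CommGroup

/-! ### The Bieri–Strebel finiteness criterion -/

section Submonoids

variable {Q : Type*} [CommGroup Q]

/-- Finitely many conditions, each monotone and satisfied somewhere in a chain, are satisfied
simultaneously by one member of the chain. -/
theorem exists_mem_chain_forall {α β : Type*} [Preorder α] {c : Set α}
    (hc : IsChain (· ≤ ·) c) (hne : c.Nonempty) {Φ : α → β → Prop}
    (hΦ : ∀ a b, a ≤ b → ∀ s, Φ a s → Φ b s) {S : Set β} (hS : S.Finite)
    (h : ∀ s ∈ S, ∃ a ∈ c, Φ a s) : ∃ a ∈ c, ∀ s ∈ S, Φ a s := by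
  induction S, hS using Set.Finite.induction_on with
  | empty =>
    obtain ⟨a, ha⟩ := hne
    exact ⟨a, ha, by simp⟩
  | @insert s S _ _ ih =>
    obtain ⟨a, ha, haS⟩ := ih fun s' hs' => h s' (Set.mem_insert_of_mem _ hs')
    obtain ⟨b, hb, hbs⟩ := h s (Set.mem_insert _ _)
    obtain ⟨d, hd, had, hbd⟩ := hc.directedOn a ha b hb
    refine ⟨d, hd, ?_⟩
    rintro s' (rfl | hs')
    · exact hΦ _ _ hbd _ hbs
    · exact hΦ _ _ had _ (haS _ hs')

theorem exists_finite_closure_eq_top [Group.FG Q] :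
    ∃ S : Set Q, S.Finite ∧ Submonoid.closure S = ⊤ := by
  obtain ⟨S, hS, hfin⟩ := Monoid.fg_iff.1 (Group.fg_iff_monoid_fg.1 ‹Group.FG Q›)
  exact ⟨S, hfin, hS⟩

/-- A proper submonoid of a finitely generated abelian group lies in a maximal proper submonoid. -/
theorem exists_le_maximal_ne_top [Group.FG Q] {P : Submonoid Q} (hP : P ≠ ⊤) :
    ∃ P' : Submonoid Q, P ≤ P' ∧ P' ≠ ⊤ ∧ ∀ x ∉ P', P' ⊔ Submonoid.powers x = ⊤ := by
  obtain ⟨S, hS, hST⟩ := exists_finite_closure_eq_top (Q := Q)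
  obtain ⟨P', hPP', hmax⟩ := zorn_le_nonempty₀ {P : Submonoid Q | P ≠ ⊤} (by
    intro c hcs hc y hy
    refine ⟨sSup c, fun htop => ?_, fun z hz => le_sSup hz⟩
    obtain ⟨a, ha, haS⟩ := exists_mem_chain_forall hc ⟨y, hy⟩
      (Φ := fun (P : Submonoid Q) q => q ∈ P) (fun _ _ hab _ h => hab h) hS (fun s _ =>
        (Submonoid.mem_sSup_of_directedOn ⟨y, hy⟩ hc.directedOn).1 (htop ▸ trivial))
    exact hcs ha (eq_top_iff.2 (hST ▸ Submonoid.closure_le.2 haS))) P hP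
  refine ⟨P', hPP', hmax.prop, fun x hx => ?_⟩
  by_contra hne
  exact hx (hmax.le_of_ge hne le_sup_left (Submonoid.mem_sup_right (Submonoid.mem_powers x)))

/-- The units `P ∩ P⁻¹` of a submonoid of an abelian group. -/
def unitSubgroup (P : Submonoid Q) : Subgroup Q where
  carrier := {x | x ∈ P ∧ x⁻¹ ∈ P}
  one_mem' := ⟨P.one_mem, by simp⟩
  mul_mem' := fun {a b} ha hb => ⟨P.mul_mem ha.1 hb.1, by
    rw [mul_inv]; exact P.mul_mem ha.2 hb.2⟩
  inv_mem' := fun {a} ha => ⟨ha.2, by simpa using ha.1⟩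

theorem mk_mem_map_iff {P : Submonoid Q} {x : Q} :
    (x : Q ⧸ unitSubgroup P) ∈ P.map (QuotientGroup.mk' (unitSubgroup P)) ↔ x ∈ P := by
  constructor
  · rintro ⟨y, hy, hyx⟩
    have := QuotientGroup.eq.1 hyx
    simpa using P.mul_mem hy this.1
  · exact fun hx => ⟨x, hx, rfl⟩

/-- The cone of `Q ⧸ (P ∩ P⁻¹)` given by a submonoid `P`. -/
def quotientCone (P : Submonoid Q) : AddGroupCone (Additive (Q ⧸ unitSubgroup P)) where
  __ := (P.map (QuotientGroup.mk' (unitSubgroup P))).toAddSubmonoid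
  eq_zero_of_mem_of_neg_mem' := by
    intro a
    obtain ⟨x, hx⟩ := QuotientGroup.mk_surjective a.toMul
    obtain rfl : a = Additive.ofMul (x : Q ⧸ unitSubgroup P) := hx.symm
    intro h₁ h₂
    have h₁' : x ∈ P := mk_mem_map_iff.1 h₁
    have h₂' : x⁻¹ ∈ P := mk_mem_map_iff.1 h₂
    exact congrArg Additive.ofMul ((QuotientGroup.eq_one_iff x).2 ⟨h₁', h₂'⟩)

theorem ofMul_mk_mem_quotientCone {P : Submonoid Q} {x : Q} :
    Additive.ofMul (x : Q ⧸ unitSubgroup P) ∈ quotientCone P ↔ x ∈ P :=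
  mk_mem_map_iff

/-- A proper total submonoid `P` of a finitely generated abelian group lies in a half-space
`Q_χ`: for a maximal proper submonoid containing `P`, the quotient by its units is an archimedean
ordered group, hence embeds in `ℝ`. -/
theorem exists_character_nonneg [Group.FG Q] {P : Submonoid Q} (hP : P ≠ ⊤)
    (htot : ∀ x, x ∈ P ∨ x⁻¹ ∈ P) :
    ∃ χ : Additive Q →+ ℝ, χ ≠ 0 ∧ ∀ p ∈ P, 0 ≤ χ (Additive.ofMul p) := by
  classical
  obtain ⟨P', hPP', hne, hmax⟩ := exists_le_maximal_ne_top hP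
  have htot' : ∀ x, x ∈ P' ∨ x⁻¹ ∈ P' := fun x => (htot x).imp (@hPP' _) (@hPP' _)
  let K := Additive (Q ⧸ unitSubgroup P')
  have hsurj : ∀ a : K, ∃ x : Q, a = Additive.ofMul (x : Q ⧸ unitSubgroup P') := fun a => by
    obtain ⟨x, hx⟩ := QuotientGroup.mk_surjective a.toMul
    exact ⟨x, hx.symm⟩
  have : HasMemOrNegMem (quotientCone P') := ⟨fun a => by
    obtain ⟨x, rfl⟩ := hsurj a
    rw [← ofMul_inv, ← QuotientGroup.mk_inv, ofMul_mk_mem_quotientCone, ofMul_mk_mem_quotientCone]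
    exact htot' x⟩
  let : LinearOrder K := LinearOrder.mkOfAddGroupCone (quotientCone P')
  have : IsOrderedAddMonoid K := IsOrderedAddMonoid.mkOfCone (quotientCone P')
  have hle : ∀ x y : Q, (Additive.ofMul (x : Q ⧸ unitSubgroup P') : K) ≤
      Additive.ofMul (y : Q ⧸ unitSubgroup P') ↔ y / x ∈ P' := fun x y =>
    ofMul_mk_mem_quotientCone (x := y / x)
  have : Archimedean K := ⟨fun a b hb => by
    obtain ⟨x, rfl⟩ := hsurj a
    obtain ⟨y, rfl⟩ := hsurj b
    have hy : y⁻¹ ∉ P' := fun hy => hb.not_ge ((hle y 1).2 (by simpa using hy))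
    -- `x⁻¹ = p * y⁻¹ ^ k` with `p ∈ P'` says that `x ≤ k y`
    obtain ⟨p, hp, _, ⟨k, rfl⟩, hk⟩ := Submonoid.mem_sup.1
      (show x⁻¹ ∈ P' ⊔ Submonoid.powers y⁻¹ from (hmax _ hy) ▸ trivial)
    refine ⟨k, (hle x (y ^ k)).2 ?_⟩
    rw [div_eq_mul_inv, ← hk]
    simpa [mul_left_comm] using hp⟩
  obtain ⟨f, hf⟩ := Archimedean.exists_orderAddMonoidHom_real_injective K
  refine ⟨f.toAddMonoidHom.comp (QuotientGroup.mk' (unitSubgroup P')).toAdditive, ?_, ?_⟩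
  · intro h0
    refine hne (eq_top_iff.2 fun x _ => ?_)
    have h1 : f (Additive.ofMul (x : Q ⧸ unitSubgroup P')) = 0 :=
      DFunLike.congr_fun h0 (Additive.ofMul x)
    have h2 : (Additive.ofMul (x : Q ⧸ unitSubgroup P') : K) = 0 := hf (h1.trans (map_zero f).symm)
    exact ((QuotientGroup.eq_one_iff x).1 (congrArg Additive.toMul h2)).1
  · intro p hp
    have h1 : (0 : K) ≤ Additive.ofMul (p : Q ⧸ unitSubgroup P') :=
      (hle 1 p).2 (by simpa using hPP' hp)
    have := f.monotone' h1
    exact (map_zero f).symm.le.trans this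

end Submonoids

section Criterion

variable {Q : Type*} [CommGroup Q] {M : Type*} [AddCommGroup M] [Module ℤ[Q] M]

theorem exists_mem_chain_mem_span {c : Set (Submonoid Q)} (hc : IsChain (· ≤ ·) c)
    (hne : c.Nonempty) {S : Set M} {m : M}
    (hm : m ∈ Submodule.span (monoidSubalgebra (sSup c)) S) :
    ∃ P ∈ c, m ∈ Submodule.span (monoidSubalgebra P) S := by
  have hmono : ∀ P P' : Submonoid Q, P ≤ P' → ∀ m : M,
      m ∈ Submodule.span (monoidSubalgebra P) S → m ∈ Submodule.span (monoidSubalgebra P') S := by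
    intro P P' h m hm
    rw [mem_span_monoidSubalgebra_iff] at hm ⊢
    exact fun W hSW hW => hm W hSW fun p hp => hW p (h hp)
  let W : AddSubgroup M :=
    { carrier := {m | ∃ P ∈ c, m ∈ Submodule.span (monoidSubalgebra P) S}
      zero_mem' := by
        obtain ⟨P, hP⟩ := hne
        exact ⟨P, hP, zero_mem _⟩
      add_mem' := by
        rintro a b ⟨P, hP, ha⟩ ⟨P', hP', hb⟩
        obtain ⟨R, hR, h₁, h₂⟩ := hc.directedOn P hP P' hP'
        exact ⟨R, hR, add_mem (hmono _ _ h₁ _ ha) (hmono _ _ h₂ _ hb)⟩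
      neg_mem' := by
        rintro a ⟨P, hP, ha⟩
        exact ⟨P, hP, neg_mem ha⟩ }
  refine mem_span_monoidSubalgebra_iff.1 hm W ?_ ?_
  · intro s hs
    obtain ⟨P, hP⟩ := hne
    exact ⟨P, hP, Submodule.subset_span hs⟩
  · rintro p hp w ⟨P, hP, hw⟩
    obtain ⟨P', hP', hpP'⟩ := (Submonoid.mem_sSup_of_directedOn hne hc.directedOn).1 hp
    obtain ⟨R, hR, h₁, h₂⟩ := hc.directedOn P hP P' hP'
    exact ⟨R, hR, Submodule.smul_mem _
      (⟨_, of_mem_monoidSubalgebra (h₂ hpP')⟩ : monoidSubalgebra R) (hmono _ _ h₁ _ hw)⟩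

/-- If `M` is finitely generated over `ℤP` for the union `P` of a chain of submonoids, then it is
finitely generated over the monoid ring of a member of the chain. -/
theorem exists_mem_chain_finite [Group.FG Q] {c : Set (Submonoid Q)} (hc : IsChain (· ≤ ·) c)
    (hne : c.Nonempty) (hM : Module.Finite (monoidSubalgebra (sSup c)) M) :
    ∃ P ∈ c, Module.Finite (monoidSubalgebra P) M := by
  obtain ⟨T, hT, hTtop⟩ := exists_finite_closure_eq_top (Q := Q)
  obtain ⟨S, hSfin, hS⟩ := Submodule.fg_def.1 hM.fg_top
  -- finitely many relations express that the span of `S` is stable under `Q`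
  obtain ⟨P, hP, hPst⟩ := exists_mem_chain_forall hc hne
    (Φ := fun (P : Submonoid Q) (x : Q × M) =>
      MonoidAlgebra.of ℤ Q x.1 • x.2 ∈ Submodule.span (monoidSubalgebra P) S)
    (by
      intro P P' h x hx
      rw [mem_span_monoidSubalgebra_iff] at hx ⊢
      exact fun W hSW hW => hx W hSW fun p hp => hW p (h hp))
    (hT.prod hSfin) (fun x _ => exists_mem_chain_mem_span hc hne (hS ▸ trivial))
  refine ⟨P, hP, ⟨Submodule.fg_def.2 ⟨S, hSfin, ?_⟩⟩⟩
  have hgen : ∀ q ∈ T, ∀ m ∈ Submodule.span (monoidSubalgebra P) S,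
      MonoidAlgebra.of ℤ Q q • m ∈ Submodule.span (monoidSubalgebra P) S := by
    intro q hq m hm
    induction hm using Submodule.span_induction with
    | mem x hx => exact hPst (q, x) ⟨hq, hx⟩
    | zero => rw [smul_zero]; exact zero_mem _
    | add x y _ _ hx hy => rw [smul_add]; exact add_mem hx hy
    | smul r x _ hx =>
      have : MonoidAlgebra.of ℤ Q q • r • x = r • MonoidAlgebra.of ℤ Q q • x := by
        rw [Subalgebra.smul_def, Subalgebra.smul_def, smul_smul, smul_smul, mul_comm]
      rw [this]
      exact Submodule.smul_mem _ r hx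
  have hall : ∀ q : Q, ∀ m ∈ Submodule.span (monoidSubalgebra P) S,
      MonoidAlgebra.of ℤ Q q • m ∈ Submodule.span (monoidSubalgebra P) S := by
    intro q
    have hq : q ∈ Submonoid.closure T := hTtop ▸ trivial
    induction hq using Submonoid.closure_induction with
    | mem x hx => exact hgen x hx
    | one => intro m hm; rwa [map_one, one_smul]
    | mul x y _ _ hx hy =>
      intro m hm
      rw [map_mul, mul_smul]
      exact hx _ (hy _ hm)
  rw [Submodule.eq_top_iff']
  intro m
  have hm : m ∈ Submodule.span (monoidSubalgebra (sSup c)) S := hS ▸ trivial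
  exact mem_span_monoidSubalgebra_iff.1 hm
    (Submodule.span (monoidSubalgebra P) S).toAddSubgroup Submodule.subset_span fun p _ => hall p

theorem exists_pos_of_ne_zero {χ : Additive Q →+ ℝ} (hχ : χ ≠ 0) :
    ∃ t : Q, 0 < χ (Additive.ofMul t) := by
  obtain ⟨x, hx⟩ := DFunLike.ne_iff.1 hχ
  rcases lt_or_gt_of_ne hx with h | h
  · exact ⟨(x.toMul)⁻¹, by rw [ofMul_inv, map_neg]; exact neg_pos.2 h⟩
  · exact ⟨x.toMul, h⟩

/-- Bieri–Strebel finiteness criterion. A finitely generated `ℤQ`-module that is finitely generated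
over `ℤQ_χ` for every nonzero `χ` with `χ|P ≥ 0` is finitely generated over `ℤP`. A submonoid
maximal among those containing `P` and violating the conclusion is total, hence lies in some `Q_χ`,
and finite generation over `ℤQ_χ` then descends to it. -/
theorem finite_monoidSubalgebra_of_forall_character [Group.FG Q] (hfin : Module.Finite ℤ[Q] M)
    {P : Submonoid Q}
    (hP : ∀ χ : Additive Q →+ ℝ, χ ≠ 0 → (∀ p ∈ P, 0 ≤ χ (Additive.ofMul p)) →
      Module.Finite (nonnegSubalgebra χ) M) : Module.Finite (monoidSubalgebra P) M := by
  by_contra hcon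
  obtain ⟨P', hPP', hmax⟩ := zorn_le_nonempty₀
    {P : Submonoid Q | ¬ Module.Finite (monoidSubalgebra P) M} (by
      intro c hcs hc y hy
      refine ⟨sSup c, fun h => ?_, fun z hz => le_sSup hz⟩
      obtain ⟨R, hR, hRfin⟩ := exists_mem_chain_finite hc ⟨y, hy⟩ h
      exact hcs hR hRfin) P hcon
  have hlarger : ∀ x ∉ P', Module.Finite (monoidSubalgebra (P' ⊔ Submonoid.powers x)) M := by
    intro x hx
    by_contra h
    exact hx (hmax.le_of_ge h le_sup_left (Submonoid.mem_sup_right (Submonoid.mem_powers x)))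
  have htot : ∀ x, x ∈ P' ∨ x⁻¹ ∈ P' := by
    intro x
    by_contra! h
    exact hmax.prop (finite_monoidSubalgebra_of_sup_powers x (hlarger _ h.1) (hlarger _ h.2))
  have hne : P' ≠ ⊤ := by
    rintro rfl
    exact hmax.prop (finite_monoidSubalgebra_top_iff.2 hfin)
  obtain ⟨χ, hχ, hχP⟩ := exists_character_nonneg hne htot
  obtain ⟨t, ht⟩ := exists_pos_of_ne_zero hχ
  obtain ⟨s, hs, hts⟩ := exists_mul_smul_eq_self (P := nonnegSubmonoid χ) ht.le
    (hP χ hχ fun p hp => hχP p (hPP' hp))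
  refine hmax.prop (finite_monoidSubalgebra_of_mul_smul_eq_self hfin ht hs hts fun q hq => ?_)
  refine (htot q).resolve_right fun hq' => ?_
  have := hχP _ hq'
  rw [ofMul_inv, map_neg] at this
  linarith

end Criterion

/-! ### Tameness and restriction to subgroups -/

section Tameness

variable {Q : Type*} [Group Q] {M : Type*} [AddCommGroup M] [Module ℤ[Q] M]

theorem nonnegSubmonoid_smul {r : ℝ} (hr : 0 < r) (χ : Additive Q →+ ℝ) :
    nonnegSubmonoid (r • χ) = nonnegSubmonoid χ := by
  ext q
  exact mul_nonneg_iff_of_pos_left hr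

theorem finite_nonnegSubalgebra_smul_iff {r : ℝ} (hr : 0 < r) (χ : Additive Q →+ ℝ) :
    Module.Finite (nonnegSubalgebra (r • χ)) M ↔ Module.Finite (nonnegSubalgebra χ) M := by
  unfold nonnegSubalgebra
  rw [nonnegSubmonoid_smul hr]

theorem rayOfNeZero_mem_sigma_iff {χ : Additive Q →+ ℝ} (hχ : χ ≠ 0) :
    rayOfNeZero ℝ χ hχ ∈ sigma Q M ↔ Module.Finite (nonnegSubalgebra χ) M := by
  constructor
  · rintro ⟨χ', hχ', heq, hfin⟩
    obtain ⟨r, hr, rfl⟩ := ((ray_eq_iff hχ hχ').1 heq).exists_pos_left hχ hχ'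
    exact (finite_nonnegSubalgebra_smul_iff hr χ).1 hfin
  · exact fun h => ⟨χ, hχ, rfl, h⟩

theorem isTame_iff {m : ℕ} : IsTame Q M m ↔ ∀ χ : Fin m → (Additive Q →+ ℝ),
    (∀ i, χ i ≠ 0 ∧ ¬ Module.Finite (nonnegSubalgebra (χ i)) M) → ∑ i, χ i ≠ 0 := by
  refine forall_congr' fun χ => imp_congr (forall_congr' fun i => ?_) Iff.rfl
  constructor
  · rintro ⟨h, hmem⟩
    exact ⟨h, fun hf => hmem ((rayOfNeZero_mem_sigma_iff h).2 hf)⟩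
  · rintro ⟨h, hnf⟩
    exact ⟨h, fun hf => hnf ((rayOfNeZero_mem_sigma_iff h).1 hf)⟩

/-- Tameness for a nonempty family of at most `n` characters: a family with fewer members is filled
up by splitting each `χ` into several copies of a positive multiple of `χ`. -/
theorem IsTame.sum_ne_zero {n : ℕ} (h : IsTame Q M n) {κ : Type*} [Fintype κ] [Nonempty κ]
    (hκ : Fintype.card κ ≤ n) (χ : κ → (Additive Q →+ ℝ)) (hχ : ∀ i, χ i ≠ 0)
    (hfin : ∀ i, ¬ Module.Finite (nonnegSubalgebra (χ i)) M) : ∑ i, χ i ≠ 0 := by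
  classical
  obtain ⟨e⟩ : Nonempty (κ ↪ Fin n) := Function.Embedding.nonempty_of_card_le (by simpa using hκ)
  let f : Fin n → κ := Function.invFun e
  have hf : Function.Surjective f := Function.invFun_surjective e.injective
  have hcard : ∀ k, (0 : ℝ) < (Finset.univ.filter (fun i => f i = k)).card := by
    intro k
    obtain ⟨i, hi⟩ := hf k
    exact Nat.cast_pos.2 (Finset.card_pos.2 ⟨i, by simp [hi]⟩)
  have hinv := fun k => inv_pos.2 (hcard k)
  have key := isTame_iff.1 h
    (fun i => ((Finset.univ.filter (fun j => f j = f i)).card : ℝ)⁻¹ • χ (f i)) fun i =>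
      ⟨smul_ne_zero (hinv _).ne' (hχ _), fun hf' =>
        hfin _ ((finite_nonnegSubalgebra_smul_iff (hinv _) _).1 hf')⟩
  convert key using 1
  rw [← Finset.sum_fiberwise (s := Finset.univ) (g := f)]
  refine Finset.sum_congr rfl fun k _ => ?_
  rw [Finset.sum_congr rfl (g := fun _ =>
    ((Finset.univ.filter (fun j => f j = k)).card : ℝ)⁻¹ • χ k) fun i hi => by
      rw [(Finset.mem_filter.1 hi).2]]
  rw [Finset.sum_const, ← Nat.cast_smul_eq_nsmul ℝ, smul_smul, mul_inv_cancel₀ (hcard k).ne',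
    one_smul]

/-- A homomorphism to `ℝ` that is nonnegative on the half-space of `χ` is a multiple of `χ`. -/
theorem exists_eq_smul_of_nonneg {χ ψ : Additive Q →+ ℝ} (hχ : χ ≠ 0)
    (h : ∀ q : Q, 0 ≤ χ (Additive.ofMul q) → 0 ≤ ψ (Additive.ofMul q)) :
    ∃ r : ℝ, 0 ≤ r ∧ ψ = r • χ := by
  obtain ⟨x, hx⟩ : ∃ x, 0 < χ x := by
    obtain ⟨x, hx⟩ := DFunLike.ne_iff.1 hχ
    rcases lt_or_gt_of_ne hx with h | h
    · exact ⟨-x, by rw [map_neg]; exact neg_pos.2 h⟩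
    · exact ⟨x, h⟩
  have h' : ∀ y : Additive Q, 0 ≤ χ y → 0 ≤ ψ y := fun y => h y.toMul
  have hψx : 0 ≤ ψ x := h' x hx.le
  have hlow : ∀ y, χ y / χ x * ψ x ≤ ψ y := by
    intro y
    rcases hψx.eq_or_lt with h0 | hpos
    · -- if `ψ x = 0`, then `-k x ≤ y` for some `k`, whence `0 ≤ ψ y`
      rw [← h0, mul_zero]
      obtain ⟨k, hk⟩ := exists_nat_gt (-χ y / χ x)
      rw [div_lt_iff₀ hx] at hk
      have := h' (y + k • x) (by rw [map_add, map_nsmul, nsmul_eq_mul]; linarith)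
      rwa [map_add, map_nsmul, ← h0, nsmul_zero, add_zero] at this
    · rw [← le_div_iff₀ hpos]
      refine le_of_forall_rat_lt_imp_le fun r hr => ?_
      rw [lt_div_iff₀ hx] at hr
      rw [le_div_iff₀ hpos]
      have hden : (0 : ℝ) < r.den := Nat.cast_pos.2 r.den_pos
      have hrq : (r : ℝ) = r.num / r.den := Rat.cast_def r
      rw [hrq, div_mul_eq_mul_div, div_lt_iff₀ hden] at hr
      have := h' (r.den • y - r.num • x) (by
        rw [map_sub, map_nsmul, map_zsmul, nsmul_eq_mul, zsmul_eq_mul]; linarith)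
      rw [map_sub, map_nsmul, map_zsmul, nsmul_eq_mul, zsmul_eq_mul] at this
      rw [hrq, div_mul_eq_mul_div, div_le_iff₀ hden]
      linarith
  refine ⟨ψ x / χ x, div_nonneg hψx hx.le, AddMonoidHom.ext fun y => ?_⟩
  have h1 := hlow y
  have h2 := hlow (-y)
  rw [map_neg, map_neg, neg_div, neg_mul] at h2
  change ψ y = ψ x / χ x * χ y
  have h3 : ψ x / χ x * χ y = χ y / χ x * ψ x := by ring
  linarith

/-- Finite generation over `ℤQ_χ` is transported by a surjection that is semilinear with respect to
an endomorphism of `Q`. -/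
theorem finite_nonnegSubalgebra_of_semilinear {α : Q →* Q} {σ : M →+ M}
    (hσ : Function.Surjective σ)
    (hασ : ∀ q m, σ (MonoidAlgebra.of ℤ Q q • m) = MonoidAlgebra.of ℤ Q (α q) • σ m)
    {χ : Additive Q →+ ℝ} (h : Module.Finite (nonnegSubalgebra (χ.comp α.toAdditive)) M) :
    Module.Finite (nonnegSubalgebra χ) M := by
  have h' : Module.Finite (monoidSubalgebra (nonnegSubmonoid (χ.comp α.toAdditive))) M := h
  change Module.Finite (monoidSubalgebra (nonnegSubmonoid χ)) M
  rw [finite_monoidSubalgebra_iff] at h' ⊢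
  obtain ⟨S, hS, h'⟩ := h'
  refine ⟨σ '' S, hS.image _, fun W hSW hW => ?_⟩
  have := h' (W.comap σ) (fun s hs => hSW ⟨s, hs, rfl⟩) (by
    intro p hp w hw
    change σ _ ∈ W
    rw [hασ]
    exact hW _ hp _ hw)
  rw [eq_top_iff]
  intro m _
  obtain ⟨m', rfl⟩ := hσ m
  exact (this ▸ trivial : m' ∈ W.comap σ)

end Tameness

section Restriction

variable {Q : Type*} [CommGroup Q] {M : Type*} [AddCommGroup M] [Module ℤ[Q] M]
variable {Q₁ : Type*} [CommGroup Q₁] {N : Type*} [AddCommGroup N] [Module ℤ[Q₁] N]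

theorem fg_of_injective [Group.FG Q] {ι : Q₁ →* Q} (hι : Function.Injective ι) : Group.FG Q₁ := by
  have : Module.Finite ℤ (Additive Q) :=
    Module.Finite.iff_addGroup_fg.2 (GroupFG.iff_add_fg.1 inferInstance)
  have : Module.Finite ℤ (Additive Q₁) :=
    Module.Finite.of_injective (ι.toAdditive.toIntLinearMap) hι
  exact GroupFG.iff_add_fg.2 (Module.Finite.iff_addGroup_fg.1 this)

theorem isNoetherianRing_monoidSubalgebra_mrange [Group.FG Q₁] (ι : Q₁ →* Q) :
    IsNoetherianRing (monoidSubalgebra (MonoidHom.mrange ι)) := by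
  have : Monoid.FG Q₁ := Group.fg_iff_monoid_fg.1 inferInstance
  have : Monoid.FG (MonoidHom.mrange ι) := Monoid.fg_range ι
  have : Algebra.FiniteType ℤ ℤ[MonoidHom.mrange ι] := MonoidAlgebra.finiteType_of_fg
  have : IsNoetherianRing ℤ[MonoidHom.mrange ι] := Algebra.FiniteType.isNoetherianRing ℤ _
  exact isNoetherianRing_of_surjective _ _
    (MonoidAlgebra.mapDomainAlgHom ℤ ℤ (MonoidHom.mrange ι).subtype).rangeRestrict.toRingHom
    (AlgHom.rangeRestrict_surjective _)

variable {ι : Q₁ →* Q} {j : N →+ M}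

/-- A `ℤQ₁`-module embedded in `M` is finitely generated if `M` is so over the image of `ℤQ₁`. -/
theorem finite_of_injective [Group.FG Q₁] (hj : Function.Injective j)
    (hjι : ∀ q n, j (MonoidAlgebra.of ℤ Q₁ q • n) = MonoidAlgebra.of ℤ Q (ι q) • j n)
    (hM : Module.Finite (monoidSubalgebra (MonoidHom.mrange ι)) M) : Module.Finite ℤ[Q₁] N := by
  have := isNoetherianRing_monoidSubalgebra_mrange ι
  have hst : ∀ p ∈ MonoidHom.mrange ι, ∀ w ∈ j.range, MonoidAlgebra.of ℤ Q p • w ∈ j.range := by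
    rintro _ ⟨q, rfl⟩ _ ⟨n, rfl⟩
    exact ⟨_, hjι q n⟩
  obtain ⟨S, hS, hspan⟩ := Submodule.fg_def.1 (IsNoetherian.noetherian (stableSubmodule j.range hst))
  rw [← finite_monoidSubalgebra_top_iff, finite_monoidSubalgebra_iff]
  refine ⟨j ⁻¹' S, hS.preimage hj.injOn, fun W hSW hW => ?_⟩
  rw [eq_top_iff]
  intro n _
  have hn : j n ∈ Submodule.span (monoidSubalgebra (MonoidHom.mrange ι)) S := by
    rw [hspan]
    exact ⟨n, rfl⟩
  obtain ⟨n', hn', heq⟩ := mem_span_monoidSubalgebra_iff.1 hn (W.map j) (by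
    intro s hs
    have hsr : s ∈ stableSubmodule j.range hst := hspan ▸ Submodule.subset_span hs
    obtain ⟨n', rfl⟩ : s ∈ j.range := hsr
    exact ⟨n', hSW hs, rfl⟩) (by
    rintro _ ⟨q, rfl⟩ _ ⟨w, hw, rfl⟩
    exact ⟨_, hW q trivial w hw, hjι q w⟩)
  rwa [← hj heq]

/-- Elements of the image of `ℤP` in `ℤQ` lift to `ℤP`, compatibly with the actions on `N` and `M`. -/
theorem exists_lift_smul
    (hjι : ∀ q n, j (MonoidAlgebra.of ℤ Q₁ q • n) = MonoidAlgebra.of ℤ Q (ι q) • j n)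
    {P : Submonoid Q₁} {r : ℤ[Q]} (hr : r ∈ monoidSubalgebra (P.map ι)) :
    ∃ r₁ ∈ monoidSubalgebra P, ∀ n, j (r₁ • n) = r • j n := by
  induction hr using monoidSubalgebra_induction with
  | of p hp =>
    obtain ⟨q, hq, rfl⟩ := hp
    exact ⟨_, of_mem_monoidSubalgebra hq, hjι q⟩
  | add x y _ _ hx hy =>
    obtain ⟨a, ha, hax⟩ := hx
    obtain ⟨b, hb, hby⟩ := hy
    exact ⟨a + b, add_mem ha hb, fun n => by rw [add_smul, map_add, hax, hby, add_smul]⟩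
  | smul k x _ hx =>
    obtain ⟨a, ha, hax⟩ := hx
    exact ⟨k • a, Subalgebra.smul_mem _ ha k, fun n => by
      rw [smul_assoc, map_zsmul, hax, smul_assoc]⟩

/-- For `M` finitely generated over the image of `ℤ(Q₁)_χ`, Nakayama's lemma gives an element of
`ℤ(Q₁)_χ` that acts as the identity on `M`, hence on `N`. This replaces a noetherian argument, as
`ℤ(Q₁)_χ` need not be noetherian. -/
theorem finite_nonnegSubalgebra_of_injective (hj : Function.Injective j)
    (hjι : ∀ q n, j (MonoidAlgebra.of ℤ Q₁ q • n) = MonoidAlgebra.of ℤ Q (ι q) • j n)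
    (hN : Module.Finite ℤ[Q₁] N) {χ : Additive Q₁ →+ ℝ} (hχ : χ ≠ 0)
    (hM : Module.Finite (monoidSubalgebra ((nonnegSubmonoid χ).map ι)) M) :
    Module.Finite (nonnegSubalgebra χ) N := by
  obtain ⟨t, ht⟩ := exists_pos_of_ne_zero hχ
  obtain ⟨s, hs, hts⟩ := exists_mul_smul_eq_self
    (P := (nonnegSubmonoid χ).map ι) (t := ι t) ⟨t, ht.le, rfl⟩ hM
  obtain ⟨s₁, hs₁, hss₁⟩ := exists_lift_smul hjι hs
  refine finite_monoidSubalgebra_of_mul_smul_eq_self hN ht hs₁ (fun n => hj ?_) fun q hq => hq.le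
  rw [mul_smul, hjι, hss₁, ← mul_smul, hts]

/-- Restriction of tameness along a norm map. Let the `α h`, `h : H`, be endomorphisms of `Q` over
which `M` has semilinear surjections, and suppose that some positive power of each norm
`∏ h, α h q` lies in the image of `Q₁`. A character vanishing on `Q₁` has norm zero, so tameness
puts it in `Σ_M`; hence `M` is finitely generated over `ℤQ₁`, and characters in the complement of
`Σ_N` extend to characters in the complement of `Σ_M`. If the former add up to zero, so do the
`H`-translates of the latter. -/
theorem finite_and_isTame_of_norm [Group.FG Q] (hM : Module.Finite ℤ[Q] M)
    {H : Type*} [Fintype H] [Nonempty H] {n d : ℕ} (hd : 0 < d) (hdn : d * Fintype.card H ≤ n)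
    (htame : IsTame Q M n) (α : H → Q →* Q) (σ : H → M →+ M)
    (hσ : ∀ h, Function.Surjective (σ h))
    (hασ : ∀ h q m, σ h (MonoidAlgebra.of ℤ Q q • m) = MonoidAlgebra.of ℤ Q (α h q) • σ h m)
    (hι : Function.Injective ι)
    (hnorm : ∀ q, ∃ m : ℕ, 0 < m ∧ ∃ q₁, ι q₁ = (∏ h, α h q) ^ m)
    (hj : Function.Injective j)
    (hjι : ∀ q n, j (MonoidAlgebra.of ℤ Q₁ q • n) = MonoidAlgebra.of ℤ Q (ι q) • j n) :
    Module.Finite ℤ[Q₁] N ∧ IsTame Q₁ N d := by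
  have hcardH : Fintype.card H ≤ n := (Nat.le_mul_of_pos_left _ hd).trans hdn
  have htrans : ∀ (h : H) {χ : Additive Q →+ ℝ}, ¬ Module.Finite (nonnegSubalgebra χ) M →
      ¬ Module.Finite (nonnegSubalgebra (χ.comp (α h).toAdditive)) M := fun h χ hχ hf =>
    hχ (finite_nonnegSubalgebra_of_semilinear (hσ h) (hασ h) hf)
  have hzero : ∀ χ : Additive Q →+ ℝ, ¬ Module.Finite (nonnegSubalgebra χ) M → χ ≠ 0 := by
    rintro _ hχ rfl
    refine hχ (finite_monoidSubalgebra_mono (P := ⊤) ?_ (finite_monoidSubalgebra_top_iff.2 hM))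
    intro q _
    exact le_refl (0 : ℝ)
  -- a sum of translates vanishes if the untranslated sum vanishes on `Q₁`
  have hsum : ∀ {κ : Type} [Fintype κ] (χ : κ → Additive Q →+ ℝ),
      (∀ q₁, ∑ i, χ i (Additive.ofMul (ι q₁)) = 0) →
      ∑ x : κ × H, (χ x.1).comp (α x.2).toAdditive = 0 := by
    intro κ _ χ hχ
    refine AddMonoidHom.ext fun q => ?_
    obtain ⟨m, hm, q₁, hq₁⟩ := hnorm q.toMul
    have h1 := hχ q₁
    rw [hq₁, ofMul_pow] at h1
    simp only [map_nsmul, ← Finset.smul_sum, ofMul_prod, map_sum] at h1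
    rw [Fintype.sum_prod_type, AddMonoidHom.finsetSum_apply]
    simp only [AddMonoidHom.finsetSum_apply]
    exact (smul_eq_zero.1 h1).resolve_left hm.ne'
  have hfin₀ : ∀ χ : Additive Q →+ ℝ, (∀ q₁, χ (Additive.ofMul (ι q₁)) = 0) →
      Module.Finite (nonnegSubalgebra χ) M := by
    intro χ hχ
    by_contra hcon
    refine htame.sum_ne_zero (κ := Unit × H) (by simpa using hcardH)
      (fun x => χ.comp (α x.2).toAdditive) (fun x => hzero _ (htrans _ hcon))
      (fun x => htrans _ hcon) (hsum (κ := Unit) (fun _ => χ) (by simpa using hχ))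
  have hFG : Group.FG Q₁ := fg_of_injective hι
  have hN : Module.Finite ℤ[Q₁] N := by
    refine finite_of_injective hj hjι (finite_monoidSubalgebra_of_forall_character hM ?_)
    intro χ _ hχ
    refine hfin₀ χ fun q₁ => le_antisymm ?_ (hχ _ ⟨q₁, rfl⟩)
    have := hχ _ ⟨q₁⁻¹, rfl⟩
    rwa [map_inv, ofMul_inv, map_neg, neg_nonneg] at this
  refine ⟨hN, isTame_iff.2 fun χ hχ hχsum => ?_⟩
  have hext : ∀ i, ∃ ψ : Additive Q →+ ℝ, ¬ Module.Finite (nonnegSubalgebra ψ) M ∧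
      ψ.comp ι.toAdditive = χ i := by
    intro i
    by_contra! hcon
    refine (hχ i).2 (finite_nonnegSubalgebra_of_injective hj hjι hN (hχ i).1
      (finite_monoidSubalgebra_of_forall_character hM fun ψ _ hψ => ?_))
    obtain ⟨r, hr, hrψ⟩ := exists_eq_smul_of_nonneg (ψ := ψ.comp ι.toAdditive) (hχ i).1
      fun q hq => hψ _ ⟨q, hq, rfl⟩
    rcases hr.eq_or_lt with rfl | hr
    · refine hfin₀ ψ fun q₁ => ?_
      rw [zero_smul] at hrψ
      exact DFunLike.congr_fun hrψ (Additive.ofMul q₁)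
    · by_contra hf
      refine hcon (r⁻¹ • ψ) (fun hf' =>
        hf ((finite_nonnegSubalgebra_smul_iff (inv_pos.2 hr) ψ).1 hf')) ?_
      calc (r⁻¹ • ψ).comp ι.toAdditive = r⁻¹ • ψ.comp ι.toAdditive := rfl
        _ = χ i := by rw [hrψ, smul_smul, inv_mul_cancel₀ hr.ne', one_smul]
  choose ψ hψ hψχ using hext
  have : Nonempty (Fin d) := ⟨⟨0, hd⟩⟩
  refine htame.sum_ne_zero (κ := Fin d × H) (by simpa using hdn)
    (fun x => (ψ x.1).comp (α x.2).toAdditive) (fun x => hzero _ (htrans _ (hψ _)))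
    (fun x => htrans _ (hψ _)) (hsum ψ fun q₁ => ?_)
  calc ∑ i, ψ i (Additive.ofMul (ι q₁)) = ∑ i, χ i (Additive.ofMul q₁) :=
        Finset.sum_congr rfl fun i _ => DFunLike.congr_fun (hψχ i) (Additive.ofMul q₁)
    _ = 0 := by rw [← AddMonoidHom.finsetSum_apply, hχsum]; rfl

end Restriction

/-! ### An abelian normal subgroup as a module -/

section ConjModule

open scoped commutatorElement

variable {G : Type*} [Group G] (A : Subgroup G) [A.Normal] [IsMulCommutative A]

/-- The identity from the `ℤ[G ⧸ A]`-module `A` to the additive group `A`. -/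
noncomputable def conjModuleEquiv : conjModule A ≃+ Additive A :=
  (conjRep A).asModuleEquiv.toAddEquiv

/-- The element of `G` underlying an element of the `ℤ[G ⧸ A]`-module `A`. -/
noncomputable def conjModuleVal (m : conjModule A) : G := ((conjModuleEquiv A m).toMul : A)

/-- An element of `A` as an element of the `ℤ[G ⧸ A]`-module `A`. -/
noncomputable def conjModuleMk (a : A) : conjModule A :=
  (conjModuleEquiv A).symm (Additive.ofMul a)

theorem conjModuleVal_mem (m : conjModule A) : conjModuleVal A m ∈ A :=
  ((conjModuleEquiv A m).toMul : A).2

theorem conjModuleVal_injective : Function.Injective (conjModuleVal A) := fun _ _ h =>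
  (conjModuleEquiv A).injective (Subtype.ext h)

theorem conjModuleVal_zero : conjModuleVal A 0 = 1 := rfl

theorem conjModuleVal_add (m n : conjModule A) :
    conjModuleVal A (m + n) = conjModuleVal A m * conjModuleVal A n := rfl

theorem conjModuleVal_neg (m : conjModule A) :
    conjModuleVal A (-m) = (conjModuleVal A m)⁻¹ := rfl

theorem conjModuleVal_of_smul (g : G) (m : conjModule A) :
    conjModuleVal A (MonoidAlgebra.of ℤ (G ⧸ A) (g : G ⧸ A) • m) =
      g * conjModuleVal A m * g⁻¹ := by
  have h : MonoidAlgebra.of ℤ (G ⧸ A) (g : G ⧸ A) • m =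
      (conjRep A).asModuleEquiv.symm (conjRep A g ((conjRep A).asModuleEquiv m)) := by
    rw [Representation.asModuleEquiv_symm_map_rho]; rfl
  rw [h]
  exact coe_conjHom_mk A g (conjModuleEquiv A m).toMul

theorem commutator_le_of_closure_eq_top {S : Set G} (hS : Subgroup.closure S = ⊤) {N : Subgroup G}
    [N.Normal] (h : ∀ x ∈ S, ∀ y ∈ S, ⁅x, y⁆ ∈ N) : commutator G ≤ N := by
  have h1 : ∀ y ∈ S, ∀ x : G, ⁅x, y⁆ ∈ N := by
    intro y hy x
    have hx : x ∈ Subgroup.closure S := hS ▸ trivial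
    rw [← QuotientGroup.eq_one_iff, ← QuotientGroup.mk'_apply, map_commutatorElement,
      commutatorElement_eq_one_iff_mul_comm]
    induction hx using Subgroup.closure_induction with
    | mem x hx =>
      rw [← commutatorElement_eq_one_iff_mul_comm, ← map_commutatorElement]
      exact (QuotientGroup.eq_one_iff _).2 (h x hx y hy)
    | one => simp
    | mul a b _ _ ha hb =>
      rw [map_mul, mul_assoc, hb, ← mul_assoc, ha, mul_assoc]
    | inv a _ ha =>
      rw [map_inv]
      exact (Commute.inv_left (show Commute _ _ from ha)).eq
  rw [commutator_def, Subgroup.commutator_le]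
  rintro x - y -
  have hy : y ∈ Subgroup.closure S := hS ▸ Subgroup.mem_top y
  rw [← QuotientGroup.eq_one_iff, ← QuotientGroup.mk'_apply, map_commutatorElement,
    commutatorElement_eq_one_iff_mul_comm]
  induction hy using Subgroup.closure_induction with
  | mem y hy =>
    rw [← commutatorElement_eq_one_iff_mul_comm, ← map_commutatorElement]
    exact (QuotientGroup.eq_one_iff _).2 (h1 y hy x)
  | one => simp
  | mul a b _ _ ha hb =>
    rw [map_mul, ← mul_assoc, ha, mul_assoc, hb, mul_assoc]
  | inv a _ ha =>
    rw [map_inv]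
    exact (Commute.inv_right (show Commute _ _ from ha)).eq

theorem subgroup_fg_of_commGroup {B : Type*} [CommGroup B] [Group.FG B] (K : Subgroup B) : K.FG :=
  (Group.fg_iff_subgroup_fg K).1 (fg_of_injective (ι := K.subtype) K.subtype_injective)

/-- `A` is finitely generated as a module over `ℤ[G ⧸ A]`: the commutators of finitely many
generators of `G` generate `G'` as a normal subgroup, and `A ⧸ G'` is a subgroup of the finitely
generated abelian group `G ⧸ G'`. -/
theorem finite_conjModule (hG : Group.FG G) [IsMulCommutative (G ⧸ A)] :
    Module.Finite ℤ[G ⧸ A] (conjModule A) := by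
  obtain ⟨S, hS, hSfin⟩ := Group.fg_iff.1 hG
  have hcomm : commutator G ≤ A := by
    rw [commutator_def, Subgroup.commutator_le]
    intro x _ y _
    rw [← QuotientGroup.eq_one_iff, ← QuotientGroup.mk'_apply, map_commutatorElement,
      commutatorElement_eq_one_iff_mul_comm]
    exact mul_comm' _ _
  have hAb : Group.FG (Abelianization G) := QuotientGroup.fg (commutator G)
  obtain ⟨T, hT, hTfin⟩ := (Subgroup.fg_iff _).1
    (subgroup_fg_of_commGroup (A.map (Abelianization.of (G := G))))
  have hTA : ∀ t : T, ∃ a : A, Abelianization.of (a : G) = t := by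
    intro t
    obtain ⟨a, ha, hat⟩ : (t : Abelianization G) ∈ A.map Abelianization.of :=
      hT ▸ Subgroup.subset_closure t.2
    exact ⟨⟨a, ha⟩, hat⟩
  choose f hf using hTA
  have := hTfin.to_subtype
  rw [← finite_monoidSubalgebra_top_iff, finite_monoidSubalgebra_iff]
  refine ⟨(fun x : G × G => conjModuleMk A ⟨⁅x.1, x.2⁆, hcomm
      (Subgroup.commutator_mem_commutator (Subgroup.mem_top _) (Subgroup.mem_top _))⟩) '' (S ×ˢ S) ∪
    Set.range fun t => conjModuleMk A (f t),
    ((hSfin.prod hSfin).image _).union (Set.finite_range _), fun W hW hst => ?_⟩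
  let N : Subgroup G :=
    { carrier := {g | ∃ m ∈ W, conjModuleVal A m = g}
      one_mem' := ⟨0, W.zero_mem, conjModuleVal_zero A⟩
      mul_mem' := by
        rintro _ _ ⟨m, hm, rfl⟩ ⟨n, hn, rfl⟩
        exact ⟨m + n, W.add_mem hm hn, conjModuleVal_add A m n⟩
      inv_mem' := by
        rintro _ ⟨m, hm, rfl⟩
        exact ⟨-m, W.neg_mem hm, conjModuleVal_neg A m⟩ }
  have hNnormal : N.Normal := ⟨by
    rintro _ ⟨m, hm, rfl⟩ g
    exact ⟨_, hst g trivial m hm, conjModuleVal_of_smul A g m⟩⟩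
  have hcN : commutator G ≤ N := commutator_le_of_closure_eq_top hS fun x hx y hy =>
    ⟨_, hW (Or.inl ⟨(x, y), ⟨hx, hy⟩, rfl⟩), rfl⟩
  have hmap : A.map (Abelianization.of (G := G)) ≤ N.map Abelianization.of := by
    rw [← hT, Subgroup.closure_le]
    intro t ht
    exact ⟨f ⟨t, ht⟩, ⟨_, hW (Or.inr ⟨⟨t, ht⟩, rfl⟩), rfl⟩, hf _⟩
  rw [eq_top_iff]
  intro m _
  obtain ⟨g, hg, hgm⟩ := hmap ⟨_, conjModuleVal_mem A m, rfl⟩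
  have h1 : g⁻¹ * conjModuleVal A m ∈ commutator G := QuotientGroup.eq.1 hgm
  obtain ⟨m', hm', hval⟩ : conjModuleVal A m ∈ N := by
    have := N.mul_mem hg (hcN h1)
    rwa [mul_inv_cancel_left] at this
  rwa [← conjModuleVal_injective A hval]

end ConjModule

/-! ### Groups of finite Prüfer rank -/

section FiniteRank

variable {K B : Type*} [Group K] [Group B]

theorem FinitePruferRank.of_injective (h : FinitePruferRank B) {f : K →* B}
    (hf : Function.Injective f) : FinitePruferRank K := by
  classical
  obtain ⟨r, hr⟩ := h
  refine ⟨r, fun L hL => ?_⟩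
  obtain ⟨S, hS, hSL⟩ := hr (L.map f) (by
    obtain ⟨T, rfl⟩ := hL
    exact ⟨T.image f, by rw [Finset.coe_image, MonoidHom.map_closure]⟩)
  refine ⟨S.preimage f hf.injOn, ?_, Subgroup.map_injective hf ?_⟩
  · refine le_trans ?_ hS
    rw [← Finset.card_image_of_injective _ hf]
    exact Finset.card_le_card (Finset.image_subset_iff.2 fun x hx => Finset.mem_preimage.1 hx)
  · rw [MonoidHom.map_closure, ← hSL, Finset.coe_preimage, Set.image_preimage_eq_of_subset]
    intro s hs
    have : s ∈ L.map f := hSL ▸ Subgroup.subset_closure hs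
    obtain ⟨x, -, hx⟩ := this
    exact ⟨x, hx⟩

theorem FinitePruferRank.of_surjective (h : FinitePruferRank K) {f : K →* B}
    (hf : Function.Surjective f) : FinitePruferRank B := by
  classical
  obtain ⟨r, hr⟩ := h
  refine ⟨r, fun L hL => ?_⟩
  obtain ⟨T, hT⟩ := hL
  obtain ⟨S, hS, hSL⟩ := hr (Subgroup.closure (T.image (Function.surjInv hf) : Finset K)) ⟨_, rfl⟩
  refine ⟨S.image f, Finset.card_image_le.trans hS, ?_⟩
  rw [Finset.coe_image, ← MonoidHom.map_closure, hSL, MonoidHom.map_closure, ← Finset.coe_image,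
    Finset.image_image, ← hT]
  congr 2
  refine (Finset.image_congr fun x _ => ?_).trans Finset.image_id
  exact Function.surjInv_eq hf x

end FiniteRank

section FiniteRankAbelian

variable {B : Type*} [CommGroup B]

/-- An abelian group of exponent dividing `n` and Prüfer rank at most `r` has at most `n ^ r`
elements. -/
theorem FinitePruferRank.finite_of_pow_eq_one (h : FinitePruferRank B)
    {n : ℕ} (hn : 0 < n) (hB : ∀ b : B, b ^ n = 1) : Finite B := by
  classical
  obtain ⟨r, hr⟩ := h
  by_contra hinf
  rw [not_finite_iff_infinite] at hinf
  obtain ⟨T, hT⟩ := Infinite.exists_subset_card_eq B (n ^ r + 1)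
  obtain ⟨S, hS, hST⟩ := hr (Subgroup.closure (T : Set B)) ⟨T, rfl⟩
  let F : (S → Fin n) → B := fun e => ∏ s : S, (s : B) ^ (e s : ℕ)
  have hmod : ∀ (b : B) (k : ℕ), b ^ k = b ^ (k % n) := fun b k => by
    conv_lhs => rw [← Nat.div_add_mod k n, pow_add, pow_mul, hB, one_pow, one_mul]
  -- the products of elements of `S` with exponents below `n` form a subgroup
  have hcl : Subgroup.closure (S : Set B) ≤
      { carrier := Set.range F
        one_mem' := ⟨fun _ => ⟨0, hn⟩, by simp [F]⟩
        mul_mem' := by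
          rintro _ _ ⟨e, rfl⟩ ⟨e', rfl⟩
          refine ⟨fun s => ⟨(e s + e' s) % n, Nat.mod_lt _ hn⟩, ?_⟩
          simp only [F, ← Finset.prod_mul_distrib, ← pow_add, ← hmod]
        inv_mem' := by
          rintro _ ⟨e, rfl⟩
          refine ⟨fun s => ⟨(n - e s) % n, Nat.mod_lt _ hn⟩, ?_⟩
          simp only [F, ← hmod, ← Finset.prod_inv_distrib]
          refine Finset.prod_congr rfl fun s _ => ?_
          rw [eq_inv_iff_mul_eq_one, ← pow_add, Nat.sub_add_cancel (e s).2.le, hB] } := by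
    rw [Subgroup.closure_le]
    intro s hs
    refine ⟨fun t => ⟨(if t = ⟨s, hs⟩ then 1 else 0) % n, Nat.mod_lt _ hn⟩, ?_⟩
    simp only [F, ← hmod]
    simp
  have hTF : T ⊆ Finset.univ.image F := by
    intro t ht
    obtain ⟨e, he⟩ := hcl (hST ▸ Subgroup.subset_closure ht)
    exact Finset.mem_image.2 ⟨e, Finset.mem_univ _, he⟩
  have h1 := (Finset.card_le_card hTF).trans Finset.card_image_le
  rw [hT, Finset.card_univ, Fintype.card_fun, Fintype.card_fin, Fintype.card_coe] at h1
  have h2 : n ^ S.card ≤ n ^ r := Nat.pow_le_pow_right hn hS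
  omega

theorem FinitePruferRank.finite_setOf_pow_eq (h : FinitePruferRank B) {n : ℕ} (hn : 0 < n) (a : B) :
    {y : B | y ^ n = a}.Finite := by
  have : Finite (powMonoidHom n : B →* B).ker :=
    (h.of_injective (Subgroup.subtype_injective _)).finite_of_pow_eq_one hn fun b =>
      Subtype.ext b.2
  rcases Set.eq_empty_or_nonempty {y : B | y ^ n = a} with h0 | ⟨y, hy⟩
  · rw [h0]; exact Set.finite_empty
  · refine (Set.finite_range fun z : (powMonoidHom n : B →* B).ker => y * z).subset fun x hx => ?_
    refine ⟨⟨y⁻¹ * x, ?_⟩, mul_inv_cancel_left y x⟩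
    rw [MonoidHom.mem_ker, powMonoidHom_apply, mul_pow, inv_pow, hy, hx, inv_mul_cancel]

theorem FinitePruferRank.exists_finite_pow_representatives (h : FinitePruferRank B) {n : ℕ}
    (hn : 0 < n) : ∃ R : Set B, R.Finite ∧ ∀ a : B, ∃ r ∈ R, ∃ e : B, a = r * e ^ n := by
  let K := (powMonoidHom n : B →* B).range
  have : Finite (B ⧸ K) :=
    (h.of_surjective (QuotientGroup.mk'_surjective K)).finite_of_pow_eq_one hn fun b => by
      induction b using QuotientGroup.induction_on with
      | H b => exact (QuotientGroup.eq_one_iff (N := K) (b ^ n)).2 ⟨b, rfl⟩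
  refine ⟨Set.range fun q : B ⧸ K => q.out, Set.finite_range _, fun a => ?_⟩
  obtain ⟨e, he⟩ : (a : B ⧸ K).out⁻¹ * a ∈ K := QuotientGroup.eq.1 (QuotientGroup.out_eq' _)
  exact ⟨_, ⟨a, rfl⟩, e, by rw [← powMonoidHom_apply, he, mul_inv_cancel_left]⟩

end FiniteRankAbelian

/-! ### The action of the finite group -/

section Action

variable {G : Type*} [Group G] {H : Type*} [Group H] [MulDistribMulAction H G] {A : Subgroup G}

/-- The endomorphism of an `H`-invariant subgroup given by `h : H`. -/
def invariantEnd (hA : ∀ (h : H), ∀ a ∈ A, h • a ∈ A) (h : H) : A →* A :=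
  ((MulDistribMulAction.toMonoidHom G h).comp A.subtype).codRestrict A fun a => hA h a a.2

theorem smul_mem_commutator (h : H) : ∀ g ∈ commutator G, h • g ∈ commutator G := by
  intro g hg
  have hmap : (commutator G).map (MulDistribMulAction.toMonoidHom G h) ≤ commutator G := by
    rw [commutator_def, Subgroup.map_commutator]
    exact Subgroup.commutator_mono le_top le_top
  exact hmap ⟨g, hg, rfl⟩

variable [A.Normal] (hA : ∀ (h : H), ∀ a ∈ A, h • a ∈ A)

theorem quotientEnd_mk (h : H) (g : G) :
    quotientEnd H hA h (g : G ⧸ A) = ((h • g : G) : G ⧸ A) := rfl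

theorem quotientEnd_quotientEnd (k h : H) (q : G ⧸ A) :
    quotientEnd H hA k (quotientEnd H hA h q) = quotientEnd H hA (k * h) q := by
  induction q using QuotientGroup.induction_on with
  | H g => rw [quotientEnd_mk, quotientEnd_mk, quotientEnd_mk, mul_smul]

theorem prod_quotientEnd_mem [Fintype H] [IsMulCommutative (G ⧸ A)] (q : G ⧸ A) :
    ∏ h, quotientEnd H hA h q ∈ quotientCentralizer H hA := by
  intro k
  rw [map_prod]
  simp_rw [quotientEnd_quotientEnd]
  exact Fintype.prod_equiv (Equiv.mulLeft k) _ _ fun h => rfl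

/-- If `A` has an `H`-invariant complement, then `H`-fixed cosets of `A` have `H`-fixed
representatives, namely those in the complement. -/
theorem exists_fixed_mk_eq_of_isComplement' {Q : Subgroup G} (hQ : Subgroup.IsComplement' A Q)
    (hQinv : ∀ h : H, ∀ q ∈ Q, h • q ∈ Q) {g : G}
    (hg : (g : G ⧸ A) ∈ quotientCentralizer H hA) :
    ∃ f ∈ FixedPoints.subgroup H G, (f : G ⧸ A) = (g : G ⧸ A) := by
  obtain ⟨⟨a, q⟩, rfl⟩ := hQ.2 g
  have haq : (((a : G) * q : G) : G ⧸ A) = ((q : G) : G ⧸ A) := by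
    rw [QuotientGroup.mk_mul, (QuotientGroup.eq_one_iff _).2 a.2, one_mul]
  change (((a : G) * q : G) : G ⧸ A) ∈ _ at hg
  change ∃ f ∈ FixedPoints.subgroup H G, (f : G ⧸ A) = (((a : G) * q : G) : G ⧸ A)
  rw [haq] at hg ⊢
  refine ⟨q, fun h => ?_, rfl⟩
  have h1 : (q : G)⁻¹ * h • (q : G) ∈ A := QuotientGroup.eq.1 (hg h).symm
  have h2 : (q : G)⁻¹ * h • (q : G) ∈ Q := Q.mul_mem (Q.inv_mem q.2) (hQinv h q q.2)
  have h3 := (Subgroup.disjoint_def.1 hQ.disjoint) h1 h2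
  exact (inv_mul_eq_one.1 h3).symm

variable [IsMulCommutative A]

/-- If `G` has finite Prüfer rank, then a power of each `H`-fixed element `gA` of `G ⧸ A` lifts to an
`H`-fixed element of `G`. The obstruction for `g ^ i` is the class of the cocycle
`k ↦ g⁻ⁱ (k • gⁱ)` in `H¹(H, A)`. This group is finite: cocycles become coboundaries after raising
to the power `n = |H|`, while `A / Aⁿ` and the `n`-torsion of `A` are finite. Hence two of these
cocycles are cohomologous, and the corresponding powers of `g` differ by a fixed element. -/
theorem exists_fixed_mk_eq_pow [Finite H] (hG : FinitePruferRank G) {g : G}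
    (hg : (g : G ⧸ A) ∈ quotientCentralizer H hA) :
    ∃ m : ℕ, 0 < m ∧ ∃ f ∈ FixedPoints.subgroup H G, (f : G ⧸ A) = (g : G ⧸ A) ^ m := by
  have := Fintype.ofFinite H
  have hrank : FinitePruferRank A := hG.of_injective A.subtype_injective
  set n := Fintype.card H with hn
  have hn0 : 0 < n := Fintype.card_pos
  have hcA : ∀ (i : ℕ) (k : H), (g ^ i)⁻¹ * k • g ^ i ∈ A := fun i k =>
    QuotientGroup.eq.1 (((quotientCentralizer H hA).pow_mem hg i) k).symm
  let c : ℕ → H → A := fun i k => ⟨_, hcA i k⟩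
  let φ : H → A →* A := invariantEnd hA
  have hcocycle : ∀ i k h, c i (k * h) = c i k * φ k (c i h) := by
    intro i k h
    refine Subtype.ext ?_
    change (g ^ i)⁻¹ * (k * h) • g ^ i = (g ^ i)⁻¹ * k • g ^ i * k • ((g ^ i)⁻¹ * h • g ^ i)
    rw [smul_mul', smul_inv', mul_smul, mul_assoc, mul_inv_cancel_left]
  -- multiply the cocycle identity over all `h`
  have hprod : ∀ i k, c i k ^ n * φ k (∏ h, c i h) = ∏ h, c i h := by
    intro i k
    rw [map_prod, hn, ← Finset.card_univ, ← Finset.prod_const, ← Finset.prod_mul_distrib]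
    exact Fintype.prod_equiv (Equiv.mulLeft k) _ _ fun h => (hcocycle i k h).symm
  obtain ⟨R, hR, hRA⟩ := hrank.exists_finite_pow_representatives hn0
  choose r hrR e hre using fun i => hRA (∏ h, c i h)
  -- `t i` is the cocycle of the representative `g ^ i * e i` of `(gA) ^ i`; by `htpow` it takes
  -- values in a finite set that does not depend on `i`
  let t : ℕ → H → A := fun i k => c i k * (e i)⁻¹ * φ k (e i)
  have htpow : ∀ i k, t i k ^ n = r i * (φ k (r i))⁻¹ := by
    intro i k
    have h1 := hprod i k
    rw [hre, map_mul, map_pow] at h1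
    rw [eq_mul_inv_iff_mul_eq, mul_pow, mul_pow, inv_pow]
    calc c i k ^ n * (e i ^ n)⁻¹ * φ k (e i) ^ n * φ k (r i)
        = c i k ^ n * (φ k (r i) * φ k (e i) ^ n) * (e i ^ n)⁻¹ := by ac_rfl
      _ = r i := by rw [h1, mul_inv_cancel_right]
  let T : Set A := ⋃ r ∈ R, ⋃ k : H, {y | y ^ n = r * (φ k r)⁻¹}
  have hT : T.Finite := hR.biUnion fun r _ => Set.finite_iUnion fun k =>
    hrank.finite_setOf_pow_eq hn0 _
  have htT : ∀ i k, t i k ∈ T := fun i k =>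
    Set.mem_biUnion (hrR i) (Set.mem_iUnion.2 ⟨k, htpow i k⟩)
  have := hT.to_subtype
  obtain ⟨i, j, hij, htij⟩ := Finite.exists_ne_map_eq_of_infinite
    fun (i : ℕ) (k : H) => (⟨t i k, htT i k⟩ : T)
  have ht : ∀ k, t i k = t j k := fun k => congrArg Subtype.val (congrFun htij k)
  have hsmul : ∀ i k, k • (g ^ i * (e i : G)) = g ^ i * (e i : G) * (t i k : G) := by
    intro i k
    have h1 : e i * t i k = c i k * φ k (e i) := by
      change e i * (c i k * (e i)⁻¹ * φ k (e i)) = _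
      rw [mul_assoc, mul_left_comm, mul_inv_cancel_left]
    rw [mul_assoc, ← Subgroup.coe_mul, h1, smul_mul', Subgroup.coe_mul, ← mul_assoc]
    change _ = g ^ i * ((g ^ i)⁻¹ * k • g ^ i) * k • (e i : G)
    rw [mul_inv_cancel_left]
  have hmk : ∀ i, ((g ^ i * (e i : G) : G) : G ⧸ A) = (g : G ⧸ A) ^ i := by
    intro i
    rw [QuotientGroup.mk_mul, (QuotientGroup.eq_one_iff _).2 (e i).2, mul_one, QuotientGroup.mk_pow]
  have main : ∀ i j, i < j → (∀ k, t i k = t j k) →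
      ∃ m : ℕ, 0 < m ∧ ∃ f ∈ FixedPoints.subgroup H G, (f : G ⧸ A) = (g : G ⧸ A) ^ m := by
    intro i j hij ht
    refine ⟨j - i, Nat.sub_pos_of_lt hij, g ^ j * e j * (g ^ i * e i)⁻¹, fun k => ?_, ?_⟩
    · rw [smul_mul', smul_inv', hsmul, hsmul, ht, mul_inv_rev, mul_assoc, mul_inv_cancel_left]
    · rw [QuotientGroup.mk_mul, QuotientGroup.mk_inv, hmk, hmk, pow_sub _ hij.le]
  rcases lt_or_gt_of_ne hij with h | h
  · exact main i j h ht
  · exact main j i h fun k => (ht k).symm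

/-- The action of `h : H` on the `ℤ[G ⧸ A]`-module `A`. -/
noncomputable def conjModuleEnd (h : H) : conjModule A →+ conjModule A :=
  (conjModuleEquiv A).symm.toAddMonoidHom.comp
    ((invariantEnd hA h).toAdditive.comp (conjModuleEquiv A).toAddMonoidHom)

theorem conjModuleVal_conjModuleEnd (h : H) (m : conjModule A) :
    conjModuleVal A (conjModuleEnd hA h m) = h • conjModuleVal A m := rfl

theorem conjModuleEnd_surjective (h : H) : Function.Surjective (conjModuleEnd hA h) := fun m =>
  ⟨conjModuleEnd hA h⁻¹ m, conjModuleVal_injective A (by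
    rw [conjModuleVal_conjModuleEnd, conjModuleVal_conjModuleEnd, smul_inv_smul])⟩

theorem conjModuleEnd_of_smul (h : H) (q : G ⧸ A) (m : conjModule A) :
    conjModuleEnd hA h (MonoidAlgebra.of ℤ _ q • m) =
      MonoidAlgebra.of ℤ _ (quotientEnd H hA h q) • conjModuleEnd hA h m := by
  induction q using QuotientGroup.induction_on with
  | H g =>
    refine conjModuleVal_injective A ?_
    rw [quotientEnd_mk, conjModuleVal_of_smul, conjModuleVal_conjModuleEnd,
      conjModuleVal_conjModuleEnd, conjModuleVal_of_smul, smul_mul', smul_mul', smul_inv']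

/-- The inclusion of `C_A(H)` into the `ℤ[G ⧸ A]`-module `A`. -/
noncomputable def centralizerInclusion : centralizerModule H hA →+ conjModule A :=
  (conjModuleEquiv A).symm.toAddMonoidHom.comp
    ((centralizerSubrep H hA).toSubmodule.subtype.toAddMonoidHom.comp
      (centralizerSubrep H hA).toRepresentation.asModuleEquiv.toAddEquiv.toAddMonoidHom)

theorem centralizerInclusion_injective : Function.Injective (centralizerInclusion hA) :=
  fun _ _ h => Subtype.ext h

theorem centralizerInclusion_of_smul (q : quotientCentralizer H hA) (m : centralizerModule H hA) :
    centralizerInclusion hA (MonoidAlgebra.of ℤ _ q • m) =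
      MonoidAlgebra.of ℤ _ (q : G ⧸ A) • centralizerInclusion hA m := by
  have h : MonoidAlgebra.of ℤ _ q • m =
      (centralizerSubrep H hA).toRepresentation.asModuleEquiv.symm
        ((centralizerSubrep H hA).toRepresentation q
          ((centralizerSubrep H hA).toRepresentation.asModuleEquiv m)) := by
    rw [Representation.asModuleEquiv_symm_map_rho]; rfl
  have h' : MonoidAlgebra.of ℤ _ (q : G ⧸ A) • centralizerInclusion hA m =
      (conjRep A).asModuleEquiv.symm (conjRep A q
        ((conjRep A).asModuleEquiv (centralizerInclusion hA m))) := by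
    rw [Representation.asModuleEquiv_symm_map_rho]; rfl
  rw [h, h']
  rfl

end Action

/-! ### Fixed points of the finite group -/

section FixedSubgroup

variable {G : Type*} [Group G] (A : Subgroup G) [A.Normal] (F : Subgroup G)

/-- The embedding of `F / (A ∩ F)` into `G / A`. -/
def quotientInclusion : F ⧸ A.subgroupOf F →* G ⧸ A :=
  QuotientGroup.map _ A F.subtype le_rfl

theorem quotientInclusion_mk (f : F) :
    quotientInclusion A F (f : F ⧸ A.subgroupOf F) = ((f : G) : G ⧸ A) := rfl

theorem quotientInclusion_injective : Function.Injective (quotientInclusion A F) := by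
  rw [injective_iff_map_eq_one]
  intro q hq
  induction q using QuotientGroup.induction_on with
  | H f => exact (QuotientGroup.eq_one_iff f).2 ((QuotientGroup.eq_one_iff (f : G)).1 hq)

variable [IsMulCommutative A]

/-- The inclusion of `A ∩ F` into `A`, as a map of modules under conjugation. -/
noncomputable def conjModuleInclusion : conjModule (A.subgroupOf F) →+ conjModule A where
  toFun m := conjModuleMk A
    ⟨(conjModuleVal (A.subgroupOf F) m : F), Subgroup.mem_subgroupOf.1 (conjModuleVal_mem _ m)⟩
  map_zero' := rfl
  map_add' _ _ := rfl

theorem conjModuleVal_conjModuleInclusion (m : conjModule (A.subgroupOf F)) :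
    conjModuleVal A (conjModuleInclusion A F m) = conjModuleVal _ m := rfl

theorem conjModuleInclusion_injective : Function.Injective (conjModuleInclusion A F) :=
  fun _ _ h => conjModuleVal_injective _ (Subtype.ext (congrArg (conjModuleVal A) h))

theorem conjModuleInclusion_of_smul (q : F ⧸ A.subgroupOf F) (m : conjModule (A.subgroupOf F)) :
    conjModuleInclusion A F (MonoidAlgebra.of ℤ _ q • m) =
      MonoidAlgebra.of ℤ _ (quotientInclusion A F q) • conjModuleInclusion A F m := by
  induction q using QuotientGroup.induction_on with
  | H f =>
    refine conjModuleVal_injective A ?_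
    rw [quotientInclusion_mk, conjModuleVal_of_smul, conjModuleVal_conjModuleInclusion,
      conjModuleVal_of_smul]
    rfl

end FixedSubgroup

section Centralizers

variable {G : Type*} [Group G] {A : Subgroup G} [A.Normal] [IsMulCommutative A]
  [IsMulCommutative (G ⧸ A)] {H : Type*} [Group H] [Finite H] [MulDistribMulAction H G]
  {n d : ℕ} (hinv : ∀ h : H, ∀ a ∈ A, h • a ∈ A)

theorem finite_and_isTame_centralizerModule (hG : Group.FG G) (hd : 0 < d)
    (hdn : d * Nat.card H ≤ n) (hA : IsTame (G ⧸ A) (conjModule A) n) :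
    Module.Finite ℤ[quotientCentralizer H hinv] (centralizerModule H hinv) ∧
      IsTame (quotientCentralizer H hinv) (centralizerModule H hinv) d := by
  have := Fintype.ofFinite H
  rw [Nat.card_eq_fintype_card] at hdn
  have : Group.FG (G ⧸ A) := QuotientGroup.fg A
  exact finite_and_isTame_of_norm (finite_conjModule A hG) hd hdn hA (quotientEnd H hinv)
    (conjModuleEnd hinv) (conjModuleEnd_surjective hinv) (conjModuleEnd_of_smul hinv)
    (ι := (quotientCentralizer H hinv).subtype) (Subgroup.subtype_injective _)
    (fun q => ⟨1, one_pos, ⟨_, prod_quotientEnd_mem hinv q⟩, (pow_one _).symm⟩)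
    (centralizerInclusion_injective hinv) (centralizerInclusion_of_smul hinv)

/-- The module `C_A(H)` over `ℤ[C_G(H)/C_A(H)]`, provided that the image of `C_G(H)` in `C_Q(H)` has
torsion quotient. -/
theorem finite_and_isTame_conjModule_fixedPoints (hG : Group.FG G) (hd : 0 < d)
    (hdn : d * Nat.card H ≤ n) (hA : IsTame (G ⧸ A) (conjModule A) n)
    (hlift : ∀ g : G, (g : G ⧸ A) ∈ quotientCentralizer H hinv →
      ∃ m : ℕ, 0 < m ∧ ∃ f ∈ FixedPoints.subgroup H G, (f : G ⧸ A) = (g : G ⧸ A) ^ m) :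
    Module.Finite ℤ[FixedPoints.subgroup H G ⧸ A.subgroupOf (FixedPoints.subgroup H G)]
        (conjModule (A.subgroupOf (FixedPoints.subgroup H G))) ∧
      IsTame (FixedPoints.subgroup H G ⧸ A.subgroupOf (FixedPoints.subgroup H G))
        (conjModule (A.subgroupOf (FixedPoints.subgroup H G))) d := by
  have := Fintype.ofFinite H
  rw [Nat.card_eq_fintype_card] at hdn
  have : Group.FG (G ⧸ A) := QuotientGroup.fg A
  have : IsMulCommutative (FixedPoints.subgroup H G ⧸ A.subgroupOf (FixedPoints.subgroup H G)) :=
    .of_comm fun x y => quotientInclusion_injective A _ (by rw [map_mul, map_mul, mul_comm'])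
  refine finite_and_isTame_of_norm (finite_conjModule A hG) hd hdn hA (quotientEnd H hinv)
    (conjModuleEnd hinv) (conjModuleEnd_surjective hinv) (conjModuleEnd_of_smul hinv)
    (quotientInclusion_injective A _) (fun q => ?_)
    (conjModuleInclusion_injective A _) (conjModuleInclusion_of_smul A _)
  obtain ⟨g, hg⟩ := QuotientGroup.mk_surjective (∏ h, quotientEnd H hinv h q)
  obtain ⟨m, hm, f, hf, hfg⟩ := hlift g (hg ▸ prod_quotientEnd_mem hinv q)
  exact ⟨m, hm, ((⟨f, hf⟩ : FixedPoints.subgroup H G) : _ ⧸ _), by rw [← hg, ← hfg]; rfl⟩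

end Centralizers

end BieriStrebel

theorem mainTheorem6 {G : Type*} [Group G] (hG : Group.FG G)
    (A : Subgroup G) [A.Normal] [IsMulCommutative A] [IsMulCommutative (G ⧸ A)]
    (H : Type*) [Group H] [Finite H] [MulDistribMulAction H G]
    (n d : ℕ) (hd : 0 < d) (hdn : d * Nat.card H ≤ n)
    (hA : BieriStrebel.IsTame (G ⧸ A) (BieriStrebel.conjModule A) n) :
    -- the `ℤ C_Q(H)`-module `C_A(H)`, with `Q = G ⧸ A`
    (∀ hinv : ∀ h : H, ∀ a ∈ A, h • a ∈ A,
      Module.Finite ℤ[BieriStrebel.quotientCentralizer H hinv]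
        (BieriStrebel.centralizerModule H hinv) ∧
      BieriStrebel.IsTame (BieriStrebel.quotientCentralizer H hinv)
        (BieriStrebel.centralizerModule H hinv) d) ∧
    -- the `ℤ[C_G(H)/C_A(H)]`-module `C_A(H)`
    ((BieriStrebel.FinitePruferRank G ∧ A = commutator G) ∨
      (∃ Q : Subgroup G, Subgroup.IsComplement' A Q ∧
        (∀ h : H, ∀ a ∈ A, h • a ∈ A) ∧ (∀ h : H, ∀ q ∈ Q, h • q ∈ Q)) →
      Module.Finite
        ℤ[FixedPoints.subgroup H G ⧸ A.subgroupOf (FixedPoints.subgroup H G)]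
        (BieriStrebel.conjModule (A.subgroupOf (FixedPoints.subgroup H G))) ∧
      BieriStrebel.IsTame
        (FixedPoints.subgroup H G ⧸ A.subgroupOf (FixedPoints.subgroup H G))
        (BieriStrebel.conjModule (A.subgroupOf (FixedPoints.subgroup H G))) d) := by
  refine ⟨fun hinv => BieriStrebel.finite_and_isTame_centralizerModule hinv hG hd hdn hA, ?_⟩
  rintro (⟨hrank, hcomm⟩ | ⟨Q, hQ, hinv, hQinv⟩)
  · have hinv : ∀ h : H, ∀ a ∈ A, h • a ∈ A := by
      rw [hcomm]
      exact BieriStrebel.smul_mem_commutator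
    exact BieriStrebel.finite_and_isTame_conjModule_fixedPoints hinv hG hd hdn hA
      fun g hg => BieriStrebel.exists_fixed_mk_eq_pow hinv hrank hg
  · refine BieriStrebel.finite_and_isTame_conjModule_fixedPoints hinv hG hd hdn hA fun g hg => ?_
    obtain ⟨f, hf, hfg⟩ := BieriStrebel.exists_fixed_mk_eq_of_isComplement' hinv hQ hQinv hg
    exact ⟨1, one_pos, f, hf, by rw [hfg, pow_one]⟩
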